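/- Let $\alpha:\mathbb R\to\mathbb R$ be measurable and suppose that there are $s>\frac12$ and $c_1,c_2>0$ with $c_1(1+|\xi|^{2s})\le\alpha(\xi)\le c_2(1+|\xi|^{2s})$ for all $\xi\in\mathbb R$. Let $f:\mathbb R\to\mathbb R$ be twice continuously differentiable with - (F1) $f(0)=0$ and $f(r)>0$ for all $r>0$; - (F2) there is $p>1$ with $r^2f'(r)\ge p\,r f(r)$ for all $r\in\mathbb R$; - (F3) there are $2\le q_1\le q_2$ and $C>0$ with $|f'(r)|\le C(|r|^{q_1-1}+|r|^{q_2-1})$ for all $r\in\mathbb R$. Write $\mathcal Fv(\xi)=\int_{\mathbb R}e^{ix\xi}v(x)\,dx$ (extended to tempered distributions), let $X=H^s(\mathbb R)$ be the Sobolev space of complex-valued functions and $X^*=H^{-s}(\mathbb R)$, so that $X\subset L^2(\mathbb R)\subset X^*$, and let $\mathcal L:X\to X^*$ be the invertible operator defined by $\mathcal F(\mathcal Lv)=\alpha\cdot\mathcal Fv$. Let $\varphi\in X$ be a real-valued solution of $\mathcal L\varphi=f(\varphi)$; then $\varphi\in L^\infty(\mathbb R)$, and one can define $$\mathcal H:X\to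 X^*,\quad \mathcal Hv=\mathcal Lv-f'(\varphi)v,\qquad\qquad \mathcal H_0:X\to X,\quad \mathcal H_0v=\mathcal L^{-1}\mathcal Hv=v-\mathcal L^{-1}(f'(\varphi)v).$$ (The operator $\mathcal H_0$ is symmetric for the inner product $(u,v)_X=\langle\mathcal Lu,v\rangle$ on $X$.) For an operator $A\in\{\mathcal H,\mathcal H_0\}$ a real number $\mu$ is an eigenvalue of $A$ if $Av=\mu v$ for some nonzero $v\in X$ (for $A=\mathcal H$ this is an equation in $X^*$), and it is simple if its eigenspace is one-dimensional. Consider the hypotheses - (H1) $A$ has exactly one negative eigenvalue, and it is simple; - (H2) $\ker A=\operatorname{span}\{\varphi'\}$. **Theorem.** If $\mathcal H_0$ satisfies (H1) and (H2), then $\mathcal H$ satisfies (H1) and (H2). -/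

import Mathlib

open MeasureTheory FourierTransform
open scoped SchwartzMap ENNReal

noncomputable section

namespace SolitaryWave

/-! ### Tempered distributions given by functions -/

/-- The tempered distribution `T` is the (measurable) function `g`, i.e. `T ψ = ∫ ψ g` for every
Schwartz function `ψ`, all these integrals being absolutely convergent. -/
def Represents (T : 𝓢'(ℝ, ℂ)) (g : ℝ → ℂ) : Prop :=
  AEStronglyMeasurable g volume ∧
    ∀ ψ : 𝓢(ℝ, ℂ), Integrable (fun x => ψ x * g x) volume ∧ T ψ = ∫ x, ψ x * g x

/-- `T` is a function `g`, and `T'` is the function `a * g`. -/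
def IsProduct (a : ℝ → ℂ) (T T' : 𝓢'(ℝ, ℂ)) : Prop :=
  ∃ g : ℝ → ℂ, Represents T g ∧ Represents T' (fun x => a x * g x)

theorem Represents.add {T T' : 𝓢'(ℝ, ℂ)} {g g' : ℝ → ℂ} (h : Represents T g)
    (h' : Represents T' g') : Represents (T + T') (fun x => g x + g' x) := by
  refine ⟨h.1.add h'.1, fun ψ => ⟨?_, ?_⟩⟩
  · simp only [mul_add]
    exact (h.2 ψ).1.add (h'.2 ψ).1
  · simp only [mul_add]
    rw [integral_add (h.2 ψ).1 (h'.2 ψ).1, ← (h.2 ψ).2, ← (h'.2 ψ).2]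
    rfl

theorem Represents.smul {T : 𝓢'(ℝ, ℂ)} {g : ℝ → ℂ} (c : ℂ) (h : Represents T g) :
    Represents (c • T) (fun x => c * g x) := by
  refine ⟨h.1.const_mul c, fun ψ => ⟨?_, ?_⟩⟩
  · simpa only [mul_left_comm] using (h.2 ψ).1.const_mul c
  · simp only [mul_left_comm _ c]
    rw [integral_const_mul, ← (h.2 ψ).2]
    rfl

theorem Represents.congr {T : 𝓢'(ℝ, ℂ)} {g g' : ℝ → ℂ} (h : Represents T g)
    (hg : g =ᵐ[volume] g') : Represents T g' := by
  have key : ∀ ψ : 𝓢(ℝ, ℂ), (fun x => ψ x * g x) =ᵐ[volume] fun x => ψ x * g' x := fun ψ => by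
    filter_upwards [hg] with x hx
    rw [hx]
  exact ⟨h.1.congr hg, fun ψ =>
    ⟨(h.2 ψ).1.congr (key ψ), (h.2 ψ).2.trans (integral_congr_ae (key ψ))⟩⟩

theorem Represents.dist_ext {T T' : 𝓢'(ℝ, ℂ)} {g : ℝ → ℂ} (h : Represents T g)
    (h' : Represents T' g) : T = T' := by
  ext ψ
  rw [(h.2 ψ).2, (h'.2 ψ).2]

theorem Represents.locallyIntegrable {T : 𝓢'(ℝ, ℂ)} {g : ℝ → ℂ} (h : Represents T g) :
    LocallyIntegrable g volume := by
  intro x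
  let b : ContDiffBump x := default
  have hg₁ : HasCompactSupport (Complex.ofRealCLM ∘ b) := b.hasCompactSupport.comp_left rfl
  have hg₂ : ContDiff ℝ (⊤ : ℕ∞) (Complex.ofRealCLM ∘ b) :=
    Complex.ofRealCLM.contDiff.comp b.contDiff
  refine ⟨Metric.ball x b.rIn, Metric.ball_mem_nhds x b.rIn_pos, ?_⟩
  refine ((h.2 (hg₁.toSchwartzMap hg₂)).1.integrableOn (s := Metric.ball x b.rIn)).congr_fun
    (fun y hy => ?_) measurableSet_ball
  have : b y = 1 := b.one_of_mem_closedBall (Metric.ball_subset_closedBall hy)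
  simp [this]

theorem Represents.ae_eq {T : 𝓢'(ℝ, ℂ)} {g g' : ℝ → ℂ} (h : Represents T g)
    (h' : Represents T g') : g =ᵐ[volume] g' := by
  have hd := (h.add (h'.smul (-1)))
  have h0 : T + (-1 : ℂ) • T = 0 := by module
  rw [h0] at hd
  have := ae_eq_zero_of_integral_contDiff_smul_eq_zero hd.locallyIntegrable (by
    intro b b_smooth b_cpt
    have hg₁ : HasCompactSupport (Complex.ofRealCLM ∘ b) := b_cpt.comp_left rfl
    have hg₂ : ContDiff ℝ (⊤ : ℕ∞) (Complex.ofRealCLM ∘ b) := by fun_prop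
    exact (hd.2 (hg₁.toSchwartzMap hg₂)).2.symm)
  filter_upwards [this] with x hx
  linear_combination hx

theorem IsProduct.unique {a : ℝ → ℂ} {T T₁ T₂ : 𝓢'(ℝ, ℂ)} (h₁ : IsProduct a T T₁)
    (h₂ : IsProduct a T T₂) : T₁ = T₂ := by
  obtain ⟨g₁, h₁, h₁'⟩ := h₁
  obtain ⟨g₂, h₂, h₂'⟩ := h₂
  refine (h₁'.congr ?_).dist_ext h₂'
  filter_upwards [h₁.ae_eq h₂] with x hx
  rw [hx]

theorem IsProduct.add {a : ℝ → ℂ} {T₁ T₂ S₁ S₂ : 𝓢'(ℝ, ℂ)} (h₁ : IsProduct a T₁ S₁)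
    (h₂ : IsProduct a T₂ S₂) : IsProduct a (T₁ + T₂) (S₁ + S₂) := by
  obtain ⟨g₁, h₁, h₁'⟩ := h₁
  obtain ⟨g₂, h₂, h₂'⟩ := h₂
  exact ⟨_, h₁.add h₂, by simpa only [mul_add] using h₁'.add h₂'⟩

theorem IsProduct.smul {a : ℝ → ℂ} {T S : 𝓢'(ℝ, ℂ)} (c : ℂ) (h : IsProduct a T S) :
    IsProduct a (c • T) (c • S) := by
  obtain ⟨g, h, h'⟩ := h
  exact ⟨_, h.smul c, by simpa only [mul_left_comm] using h'.smul c⟩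

/-! ### Sobolev spaces -/

/-- The Sobolev space `H^q(ℝ)` of complex-valued tempered distributions. -/
def Sobolev (q : ℝ) : Submodule ℂ 𝓢'(ℝ, ℂ) where
  carrier := {u | TemperedDistribution.MemSobolev q 2 u}
  add_mem' hu hv := hu.add hv
  zero_mem' := TemperedDistribution.memSobolev_fun_zero ℝ ℂ q 2
  smul_mem' c _ hu := hu.smul c

theorem represents_lp {p : ℝ≥0∞} [Fact (1 ≤ p)] (h : Lp ℂ p (volume : Measure ℝ)) :
    Represents (h : 𝓢'(ℝ, ℂ)) h := by
  refine ⟨Lp.aestronglyMeasurable h, fun ψ => ⟨?_, ?_⟩⟩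
  · have := ENNReal.HolderConjugate.inv_one_sub_inv' (Fact.out : 1 ≤ p)
    exact MemLp.integrable_mul (p := (1 - p⁻¹)⁻¹) (q := p) (ψ.memLp _ _) (Lp.memLp h)
  · simp

theorem represents_smulLeft {T : 𝓢'(ℝ, ℂ)} {g m : ℝ → ℂ} (hm : m.HasTemperateGrowth)
    (h : Represents T g) :
    Represents (TemperedDistribution.smulLeftCLM ℂ m T) (fun x => m x * g x) := by
  refine ⟨hm.1.continuous.aestronglyMeasurable.mul h.1, fun ψ => ?_⟩
  have := h.2 (SchwartzMap.smulLeftCLM ℂ m ψ)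
  simp only [SchwartzMap.smulLeftCLM_apply_apply hm, smul_eq_mul] at this
  simp only [TemperedDistribution.smulLeftCLM_apply_apply]
  simpa only [mul_assoc, mul_left_comm] using this

/-- The weight `(1 + ξ²)^{q/2}`. -/
def weight (q : ℝ) (ξ : ℝ) : ℂ := (((1 + ‖ξ‖ ^ 2) ^ (q / 2) : ℝ) : ℂ)

theorem weight_hasTemperateGrowth (q : ℝ) : (weight q).HasTemperateGrowth := by
  unfold weight
  fun_prop

theorem weight_mul (q r ξ : ℝ) : weight q ξ * weight r ξ = weight (q + r) ξ := by
  simp only [weight]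
  rw [← Complex.ofReal_mul, ← Real.rpow_add (by positivity), add_div]

theorem weight_zero (ξ : ℝ) : weight 0 ξ = 1 := by simp [weight]

theorem exists_fourier_represents {q : ℝ} {u : 𝓢'(ℝ, ℂ)} (hu : u ∈ Sobolev q) :
    ∃ g : ℝ → ℂ, Represents (𝓕 u) g ∧ MemLp (fun ξ => weight q ξ * g ξ) 2 volume := by
  obtain ⟨h, hh⟩ := TemperedDistribution.memSobolev_iff_exists_smulLeftCLM_fourier.1 hu
  change TemperedDistribution.smulLeftCLM ℂ (weight q) (𝓕 u) = h at hh
  have h2 := represents_smulLeft (weight_hasTemperateGrowth (-q)) (represents_lp h)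
  rw [← hh, TemperedDistribution.smulLeftCLM_smulLeftCLM_apply (weight_hasTemperateGrowth _)
    (weight_hasTemperateGrowth _)] at h2
  have h3 : weight q * weight (-q) = fun _ => (1 : ℂ) := by
    ext ξ
    simp [weight_mul, weight_zero]
  rw [h3, TemperedDistribution.smulLeftCLM_const, one_smul] at h2
  refine ⟨_, h2, (memLp_congr_ae (Filter.Eventually.of_forall fun ξ => ?_)).1 (Lp.memLp h)⟩
  simp only [← mul_assoc, weight_mul]
  simp [weight_zero]

theorem exists_of_memLp {q : ℝ} {g : ℝ → ℂ}
    (hg : MemLp (fun ξ => weight q ξ * g ξ) 2 volume) :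
    ∃ u ∈ Sobolev q, Represents (𝓕 u) g := by
  have h2 := represents_smulLeft (weight_hasTemperateGrowth (-q)) (represents_lp hg.toLp)
  refine ⟨𝓕⁻ (TemperedDistribution.smulLeftCLM ℂ (weight (-q)) (hg.toLp : 𝓢'(ℝ, ℂ))), ?_, ?_⟩
  · refine TemperedDistribution.memSobolev_iff_exists_smulLeftCLM_fourier.2 ⟨hg.toLp, ?_⟩
    change TemperedDistribution.smulLeftCLM ℂ (weight q) _ = _
    rw [fourier_fourierInv_eq, TemperedDistribution.smulLeftCLM_smulLeftCLM_apply
      (weight_hasTemperateGrowth _) (weight_hasTemperateGrowth _)]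
    have h3 : weight (-q) * weight q = fun _ => (1 : ℂ) := by
      ext ξ
      simp [weight_mul, weight_zero]
    rw [h3, TemperedDistribution.smulLeftCLM_const, one_smul]
  · rw [fourier_fourierInv_eq]
    refine h2.congr ?_
    filter_upwards [hg.coeFn_toLp] with ξ hξ
    rw [hξ, ← mul_assoc, weight_mul]
    simp [weight_zero]

/-! ### The operator `𝓛` -/

/-- `α` is (Lebesgue) measurable and comparable with `1 + |ξ|^{2s}`, where `s > 1/2`. -/
structure IsSymbol (α : ℝ → ℝ) (s : ℝ) : Prop where
  half_lt : 1 / 2 < s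
  aemeasurable : AEMeasurable α volume
  bounds : ∃ c₁ c₂ : ℝ, 0 < c₁ ∧ 0 < c₂ ∧ ∀ ξ : ℝ,
    c₁ * (1 + |ξ| ^ (2 * s)) ≤ α ξ ∧ α ξ ≤ c₂ * (1 + |ξ| ^ (2 * s))

/-- The symbol `α` in the frequency variable of Mathlib's Fourier transform.
With `(F v)(ξ) = ∫ e^{i x ξ} v(x) dx` and Mathlib's `(𝓕 v)(η) = ∫ e^{-2π i x η} v(x) dx`, one has
`(𝓕 v)(η) = (F v)(-2π η)`, so that multiplication of `F v` by `α` is multiplication of `𝓕 v` by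
`η ↦ α (-2π η)`. -/
def symbol (α : ℝ → ℝ) (η : ℝ) : ℂ := (α (-(2 * Real.pi) * η) : ℂ)

theorem IsSymbol.symbol_aestronglyMeasurable {α : ℝ → ℝ} {s : ℝ} (hα : IsSymbol α s) :
    AEStronglyMeasurable (symbol α) volume := by
  have h : AEMeasurable (fun η : ℝ => α (-(2 * Real.pi) * η)) volume :=
    hα.aemeasurable.comp_quasiMeasurePreserving
      (Measure.quasiMeasurePreserving_smul volume (neg_ne_zero.2 Real.two_pi_pos.ne'))
  exact (Complex.measurable_ofReal.comp_aemeasurable h).aestronglyMeasurable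

theorem IsSymbol.symbol_ne_zero {α : ℝ → ℝ} {s : ℝ} (hα : IsSymbol α s) (η : ℝ) :
    symbol α η ≠ 0 := by
  obtain ⟨c₁, c₂, h₁, h₂, h⟩ := hα.bounds
  have := (h (-(2 * Real.pi) * η)).1
  have h3 : 0 < c₁ * (1 + |-(2 * Real.pi) * η| ^ (2 * s)) := by positivity
  exact Complex.ofReal_ne_zero.2 (h3.trans_le this).ne'

theorem norm_weight (q ξ : ℝ) : ‖weight q ξ‖ = (1 + ξ ^ 2) ^ (q / 2) := by
  rw [weight, Complex.norm_real, Real.norm_of_nonneg (by positivity), Real.norm_eq_abs, sq_abs]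

theorem IsSymbol.norm_symbol_le {α : ℝ → ℝ} {s : ℝ} (hα : IsSymbol α s) :
    ∃ C, ∀ η, ‖symbol α η‖ ≤ C * ‖weight (2 * s) η‖ := by
  obtain ⟨c₁, c₂, h₁, h₂, h⟩ := hα.bounds
  have hs : 0 < s := by linarith [hα.half_lt]
  refine ⟨c₂ * (1 + (2 * Real.pi) ^ (2 * s)), fun η => ?_⟩
  have hb := h (-(2 * Real.pi) * η)
  have h3 : 0 < c₁ * (1 + |-(2 * Real.pi) * η| ^ (2 * s)) := by positivity
  rw [norm_weight, symbol, Complex.norm_real, Real.norm_of_nonneg (h3.le.trans hb.1)]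
  refine hb.2.trans ?_
  rw [mul_assoc]
  refine mul_le_mul_of_nonneg_left ?_ h₂.le
  have e1 : |-(2 * Real.pi) * η| = 2 * Real.pi * |η| := by
    rw [abs_mul, abs_neg, abs_of_pos Real.two_pi_pos]
  have e2 : |η| ^ (2 * s) ≤ (1 + η ^ 2) ^ (2 * s / 2) := by
    rw [show 2 * s / 2 = s by ring, Real.rpow_mul (abs_nonneg _), Real.rpow_two, sq_abs]
    exact Real.rpow_le_rpow (by positivity) (by linarith) hs.le
  have e3 : (1 : ℝ) ≤ (1 + η ^ 2) ^ (2 * s / 2) :=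
    Real.one_le_rpow (by nlinarith [sq_nonneg η]) (by linarith)
  rw [e1, Real.mul_rpow (by positivity) (abs_nonneg _), add_mul, one_mul]
  gcongr

theorem IsSymbol.norm_inv_symbol_le {α : ℝ → ℝ} {s : ℝ} (hα : IsSymbol α s) :
    ∃ C, ∀ η, ‖(symbol α η)⁻¹‖ ≤ C * ‖weight (-(2 * s)) η‖ := by
  obtain ⟨c₁, c₂, h₁, h₂, h⟩ := hα.bounds
  have hs : 0 < s := by linarith [hα.half_lt]
  refine ⟨2 ^ s / c₁, fun η => ?_⟩
  have hb := h (-(2 * Real.pi) * η)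
  have h3 : 0 < c₁ * (1 + |-(2 * Real.pi) * η| ^ (2 * s)) := by positivity
  rw [norm_inv, norm_weight, symbol, Complex.norm_real, Real.norm_of_nonneg (h3.le.trans hb.1)]
  have e0 : (1 + η ^ 2 : ℝ) ^ (-(2 * s) / 2) = ((1 + η ^ 2) ^ s)⁻¹ := by
    rw [← Real.rpow_neg (by positivity)]
    congr 1
    ring
  have e1 : |η| ≤ |-(2 * Real.pi) * η| := by
    rw [abs_mul, abs_neg, abs_of_pos Real.two_pi_pos]
    nlinarith [abs_nonneg η, Real.pi_gt_three]
  have e2 : (1 + η ^ 2 : ℝ) ^ s ≤ 2 ^ s * (1 + |-(2 * Real.pi) * η| ^ (2 * s)) := by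
    have e3 : (η ^ 2) ^ s ≤ |-(2 * Real.pi) * η| ^ (2 * s) := by
      rw [Real.rpow_mul (abs_nonneg _), Real.rpow_two, ← sq_abs η]
      exact Real.rpow_le_rpow (by positivity) (by gcongr) hs.le
    have e4 : (1 + η ^ 2 : ℝ) ^ s ≤ (2 * max 1 (η ^ 2)) ^ s :=
      Real.rpow_le_rpow (by positivity)
        (by linarith [le_max_left 1 (η ^ 2), le_max_right 1 (η ^ 2)]) hs.le
    refine e4.trans ?_
    rw [Real.mul_rpow (by norm_num) (by positivity)]
    gcongr
    rcases le_total 1 (η ^ 2) with h5 | h5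
    · rw [max_eq_right h5]
      linarith
    · rw [max_eq_left h5, Real.one_rpow]
      linarith [Real.rpow_nonneg (abs_nonneg (-(2 * Real.pi) * η)) (2 * s)]
  rw [e0, ← div_eq_mul_inv, div_div, inv_le_comm₀ (h3.trans_le hb.1) (by positivity), inv_div]
  refine le_trans ?_ hb.1
  rw [div_le_iff₀ (by positivity)]
  nlinarith [mul_le_mul_of_nonneg_left e2 h₁.le]

theorem memLp_weight_mul {q r : ℝ} {a g : ℝ → ℂ} (ha : AEStronglyMeasurable a volume)
    (hC : ∃ C, ∀ ξ, ‖a ξ‖ ≤ C * ‖weight (q - r) ξ‖) (hm : AEStronglyMeasurable g volume)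
    (hg : MemLp (fun ξ => weight q ξ * g ξ) 2 volume) :
    MemLp (fun ξ => weight r ξ * (a ξ * g ξ)) 2 volume := by
  obtain ⟨C, hC⟩ := hC
  refine hg.of_le_mul (c := C)
    ((weight_hasTemperateGrowth r).1.continuous.aestronglyMeasurable.mul (ha.mul hm))
    (Filter.Eventually.of_forall fun ξ => ?_)
  calc ‖weight r ξ * (a ξ * g ξ)‖ = ‖weight r ξ‖ * ‖a ξ‖ * ‖g ξ‖ := by
        rw [norm_mul, norm_mul, mul_assoc]
    _ ≤ ‖weight r ξ‖ * (C * ‖weight (q - r) ξ‖) * ‖g ξ‖ := by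
        gcongr
        exact hC ξ
    _ = C * (‖weight r ξ * weight (q - r) ξ‖ * ‖g ξ‖) := by
        rw [norm_mul]
        ring
    _ = C * ‖weight q ξ * g ξ‖ := by
        rw [weight_mul, norm_mul]
        ring_nf

theorem IsSymbol.exists_apply {α : ℝ → ℝ} {s : ℝ} (hα : IsSymbol α s) (v : Sobolev s) :
    ∃ w : Sobolev (-s), IsProduct (symbol α) (𝓕 (v : 𝓢'(ℝ, ℂ))) (𝓕 (w : 𝓢'(ℝ, ℂ))) := by
  obtain ⟨g, hg, hg'⟩ := exists_fourier_represents v.2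
  obtain ⟨w, hw, hw'⟩ := exists_of_memLp (q := -s) (memLp_weight_mul
    hα.symbol_aestronglyMeasurable (by simpa [two_mul] using hα.norm_symbol_le) hg.1 hg')
  exact ⟨⟨w, hw⟩, g, hg, hw'⟩

/-- `𝓛 : H^s → H^{-s}`, `F(𝓛 v) = α · F v`. -/
def IsSymbol.opL {α : ℝ → ℝ} {s : ℝ} (hα : IsSymbol α s) : Sobolev s →ₗ[ℂ] Sobolev (-s) where
  toFun v := (hα.exists_apply v).choose
  map_add' v w := by
    apply Subtype.ext
    apply (fourierEquiv ℂ 𝓢'(ℝ, ℂ)).injective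
    refine (hα.exists_apply (v + w)).choose_spec.unique ?_
    simpa [FourierTransform.fourier_add] using
      (hα.exists_apply v).choose_spec.add (hα.exists_apply w).choose_spec
  map_smul' c v := by
    apply Subtype.ext
    apply (fourierEquiv ℂ 𝓢'(ℝ, ℂ)).injective
    refine (hα.exists_apply (c • v)).choose_spec.unique ?_
    simpa [FourierTransform.fourier_smul] using
      (hα.exists_apply v).choose_spec.smul c

theorem IsSymbol.opL_spec {α : ℝ → ℝ} {s : ℝ} (hα : IsSymbol α s) (v : Sobolev s) :
    IsProduct (symbol α) (𝓕 (v : 𝓢'(ℝ, ℂ))) (𝓕 (hα.opL v : 𝓢'(ℝ, ℂ))) :=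
  (hα.exists_apply v).choose_spec

theorem IsSymbol.opL_bijective {α : ℝ → ℝ} {s : ℝ} (hα : IsSymbol α s) :
    Function.Bijective hα.opL := by
  have finj : Function.Injective (fun T : 𝓢'(ℝ, ℂ) => 𝓕 T) :=
    (fourierEquiv ℂ 𝓢'(ℝ, ℂ)).injective
  have f0 : 𝓕 (0 : 𝓢'(ℝ, ℂ)) = 0 := (fourierEquiv ℂ 𝓢'(ℝ, ℂ)).map_zero
  constructor
  · rw [injective_iff_map_eq_zero]
    intro v hv
    obtain ⟨g, hg, hg'⟩ := hα.opL_spec v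
    have h0 : Represents (0 : 𝓢'(ℝ, ℂ)) (fun _ => 0) :=
      ⟨aestronglyMeasurable_const, fun ψ => by simp⟩
    rw [hv, ZeroMemClass.coe_zero, f0] at hg'
    apply Subtype.ext
    apply finj
    simp only [ZeroMemClass.coe_zero, f0]
    refine (hg.congr ?_).dist_ext h0
    filter_upwards [hg'.ae_eq h0] with x hx
    exact (mul_eq_zero.1 hx).resolve_left (hα.symbol_ne_zero x)
  · intro w
    obtain ⟨g, hg, hg'⟩ := exists_fourier_represents w.2
    obtain ⟨v, hv, hv'⟩ := exists_of_memLp (q := s) (memLp_weight_mul (q := -s)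
      (a := fun ξ => (symbol α ξ)⁻¹)
      hα.symbol_aestronglyMeasurable.inv₀ (by
        have := hα.norm_inv_symbol_le
        rwa [show -(2 * s) = -s - s by ring] at this) hg.1 hg')
    refine ⟨⟨v, hv⟩, Subtype.ext (finj ?_)⟩
    refine (hα.opL_spec ⟨v, hv⟩).unique ⟨_, hv', hg.congr (Filter.Eventually.of_forall fun ξ => ?_)⟩
    simp [mul_inv_cancel_left₀ (hα.symbol_ne_zero ξ)]

/-- `𝓛` is invertible from `X = H^s` onto `X* = H^{-s}`. -/
def IsSymbol.equivL {α : ℝ → ℝ} {s : ℝ} (hα : IsSymbol α s) :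
    Sobolev s ≃ₗ[ℂ] Sobolev (-s) :=
  LinearEquiv.ofBijective hα.opL hα.opL_bijective

/-! ### The nonlinearity and the linearized operators -/

/-- `f` is `C²`, `f(0) = 0`, `f > 0` on `(0, ∞)`, `r² f'(r) ≥ p r f(r)` for some `p > 1`, and
`|f'(r)| ≤ C (|r|^{q₁-1} + |r|^{q₂-1})` for some `2 ≤ q₁ ≤ q₂`. -/
structure IsNonlinearity (f : ℝ → ℝ) : Prop where
  contDiff : ContDiff ℝ 2 f
  map_zero : f 0 = 0
  pos : ∀ r, 0 < r → 0 < f r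
  superlinear : ∃ p : ℝ, 1 < p ∧ ∀ r : ℝ, p * r * f r ≤ r ^ 2 * deriv f r
  growth : ∃ q₁ q₂ C : ℝ, 2 ≤ q₁ ∧ q₁ ≤ q₂ ∧ 0 < C ∧
    ∀ r, |deriv f r| ≤ C * (|r| ^ (q₁ - 1) + |r| ^ (q₂ - 1))

/-- The real-valued function `φ`, whose class in `X = H^s` is `u`, solves `𝓛 φ = f(φ)`. -/
structure IsSolution {α : ℝ → ℝ} {s : ℝ} (hα : IsSymbol α s) (f φ : ℝ → ℝ) (u : Sobolev s) :
    Prop where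
  represents : Represents (u : 𝓢'(ℝ, ℂ)) (fun x => (φ x : ℂ))
  equation : Represents (hα.opL u : 𝓢'(ℝ, ℂ)) (fun x => (f (φ x) : ℂ))

theorem sobolev_ae_bounded {s : ℝ} (hs : 1 / 2 < s) (u : Sobolev s) {g : ℝ → ℂ}
    (hg : Represents (u : 𝓢'(ℝ, ℂ)) g) : ∃ B, ∀ᵐ x, ‖g x‖ ≤ B := by
  have hs' : (Module.finrank ℝ ℝ : ℝ) < 2 * s := by
    rw [Module.finrank_self]
    push_cast
    linarith
  obtain ⟨v, hv⟩ := TemperedDistribution.MemSobolev.fourier_memL1 hs' u.2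
  have hint : Integrable v volume := memLp_one_iff_integrable.1 (Lp.memLp v)
  have hcont : Continuous (𝓕⁻ (v : ℝ → ℂ)) :=
    VectorFourier.fourierIntegral_continuous Real.continuous_fourierChar
      (L := -innerₗ ℝ) (by fun_prop) hint
  have hbd : ∀ x, ‖𝓕⁻ (v : ℝ → ℂ) x‖ ≤ ∫ ξ, ‖v ξ‖ := fun x =>
    VectorFourier.norm_fourierIntegral_le_integral_norm _ _ (-innerₗ ℝ) _ x
  have hrep : Represents (u : 𝓢'(ℝ, ℂ)) (𝓕⁻ (v : ℝ → ℂ)) := by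
    refine ⟨hcont.aestronglyMeasurable, fun ψ => ⟨?_, ?_⟩⟩
    · exact ψ.integrable.mul_bdd hcont.aestronglyMeasurable
        (Filter.Eventually.of_forall hbd)
    · have h1 : (u : 𝓢'(ℝ, ℂ)) ψ = (𝓕 (u : 𝓢'(ℝ, ℂ))) (𝓕⁻ ψ) := by simp
      rw [h1, hv, ((represents_lp v).2 _).2]
      have h2 := VectorFourier.integral_fourierIntegral_smul_eq_flip (μ := volume) (ν := volume)
        (L := -innerₗ ℝ) (f := (ψ : ℝ → ℂ)) (g := (v : ℝ → ℂ)) Real.continuous_fourierChar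
        (by fun_prop) ψ.integrable hint
      have h3 : (-innerₗ ℝ).flip = -innerₗ ℝ := by
        ext
        simp
      rw [h3] at h2
      simp only [smul_eq_mul, SchwartzMap.fourierInv_coe] at h2 ⊢
      exact h2
  refine ⟨∫ ξ, ‖v ξ‖, ?_⟩
  filter_upwards [hg.ae_eq hrep] with x hx
  rw [hx]
  exact hbd x

theorem IsSolution.potential_memLp {α : ℝ → ℝ} {s : ℝ} {hα : IsSymbol α s} {f φ : ℝ → ℝ}
    {u : Sobolev s} (hf : IsNonlinearity f) (hφ : IsSolution hα f φ u) :
    MemLp (fun x => ((deriv f (φ x) : ℝ) : ℂ)) ∞ volume := by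
  have hcont : Continuous (deriv f) := hf.contDiff.continuous_deriv (by norm_num)
  obtain ⟨B, hB⟩ := sobolev_ae_bounded hα.half_lt u hφ.represents
  obtain ⟨C, hC⟩ := (isCompact_Icc (a := -B) (b := B)).exists_bound_of_continuousOn
    hcont.continuousOn
  have hm : AEMeasurable φ volume :=
    Complex.measurable_re.comp_aemeasurable hφ.represents.1.aemeasurable
  refine memLp_top_of_bound
    (Complex.measurable_ofReal.comp_aemeasurable
      (hcont.measurable.comp_aemeasurable hm)).aestronglyMeasurable C ?_
  filter_upwards [hB] with x hx
  rw [Complex.norm_real] at hx ⊢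
  exact hC _ (abs_le.1 hx)

theorem exists_mul {s : ℝ} (hs : 0 ≤ s) {V : ℝ → ℂ} (hV : MemLp V ∞ volume) (v : Sobolev s) :
    ∃ w : Sobolev (-s), IsProduct V (v : 𝓢'(ℝ, ℂ)) (w : 𝓢'(ℝ, ℂ)) := by
  obtain ⟨h, hh⟩ := TemperedDistribution.memSobolev_zero_iff.1
    (TemperedDistribution.MemSobolev.mono hs v.2)
  have hm : MemLp (fun x => V x * h x) 2 volume := (Lp.memLp h).mul hV
  refine ⟨⟨(hm.toLp : 𝓢'(ℝ, ℂ)), TemperedDistribution.MemSobolev.mono (neg_nonpos.2 hs)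
    (TemperedDistribution.memSobolev_zero_iff.2 ⟨_, rfl⟩)⟩, h, ?_, ?_⟩
  · rw [hh]
    exact represents_lp h
  · exact (represents_lp hm.toLp).congr hm.coeFn_toLp

/-- Multiplication by a bounded function `V`, as an operator from `H^s` to `H^{-s}`, `s ≥ 0`. -/
def opMul {s : ℝ} (hs : 0 ≤ s) {V : ℝ → ℂ} (hV : MemLp V ∞ volume) :
    Sobolev s →ₗ[ℂ] Sobolev (-s) where
  toFun v := (exists_mul hs hV v).choose
  map_add' v w := by
    apply Subtype.ext
    refine (exists_mul hs hV (v + w)).choose_spec.unique ?_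
    simpa using (exists_mul hs hV v).choose_spec.add (exists_mul hs hV w).choose_spec
  map_smul' c v := by
    apply Subtype.ext
    refine (exists_mul hs hV (c • v)).choose_spec.unique ?_
    simpa using (exists_mul hs hV v).choose_spec.smul c

theorem opMul_spec {s : ℝ} (hs : 0 ≤ s) {V : ℝ → ℂ} (hV : MemLp V ∞ volume) (v : Sobolev s) :
    IsProduct V (v : 𝓢'(ℝ, ℂ)) (opMul hs hV v : 𝓢'(ℝ, ℂ)) :=
  (exists_mul hs hV v).choose_spec

theorem IsSymbol.nonneg {α : ℝ → ℝ} {s : ℝ} (hα : IsSymbol α s) : 0 ≤ s := by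
  linarith [hα.half_lt]

section operators

variable {α : ℝ → ℝ} {s : ℝ} {hα : IsSymbol α s} {f φ : ℝ → ℝ} {u : Sobolev s}

/-- The linearized operator `𝓗 v = 𝓛 v - f'(φ) v`, from `X = H^s` to `X* = H^{-s}`. -/
def opH (hf : IsNonlinearity f) (hφ : IsSolution hα f φ u) : Sobolev s →ₗ[ℂ] Sobolev (-s) :=
  hα.opL - opMul hα.nonneg (hφ.potential_memLp hf)

/-- The operator `𝓗₀ = 𝓛⁻¹ 𝓗` from `X` to `X`. -/
def opH₀ (hf : IsNonlinearity f) (hφ : IsSolution hα f φ u) : Sobolev s →ₗ[ℂ] Sobolev s :=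
  hα.equivL.symm.toLinearMap ∘ₗ opH hf hφ

/-- The inclusion of `X = H^s` into `X* = H^{-s}`. -/
def incl (hα : IsSymbol α s) : Sobolev s →ₗ[ℂ] Sobolev (-s) :=
  Submodule.inclusion fun _ hv =>
    TemperedDistribution.MemSobolev.mono (by linarith [hα.nonneg]) hv

end operators

/-! ### The spectral hypotheses -/

/-- The space of solutions of `A v = μ v` for an operator `A : V → W`, where `V` is seen inside
`W` through the map `j`. -/
def eigenspace {V W : Type*} [AddCommGroup V] [Module ℂ V] [AddCommGroup W] [Module ℂ W]
    (j A : V →ₗ[ℂ] W) (μ : ℝ) : Submodule ℂ V :=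
  LinearMap.ker (A - (μ : ℂ) • j)

/-- `A` has exactly one negative eigenvalue, and it is simple. -/
def HypH1 {V W : Type*} [AddCommGroup V] [Module ℂ V] [AddCommGroup W] [Module ℂ W]
    (j A : V →ₗ[ℂ] W) : Prop :=
  ∃ μ : ℝ, μ < 0 ∧ Module.finrank ℂ (eigenspace j A μ) = 1 ∧
    ∀ ν : ℝ, ν < 0 → eigenspace j A ν ≠ ⊥ → ν = μ

/-- `ker A = span {φ'}`, an equality of spaces of tempered distributions, where `φ'` is the
distributional derivative of the function `φ` with class `u` in `H^s`. -/
def HypH2 {s : ℝ} {W : Type*} [AddCommGroup W] [Module ℂ W] (A : Sobolev s →ₗ[ℂ] W)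
    (u : Sobolev s) : Prop :=
  (LinearMap.ker A).map (Sobolev s).subtype =
    Submodule.span ℂ {TemperedDistribution.derivCLM ℂ (u : 𝓢'(ℝ, ℂ))}

end SolitaryWave

end

/-!
Every `v ∈ H^s` is uniquely `v = 𝓕⁻¹ (α^{-1/2} h)` with `h ∈ L²` (`IsSymbol.param`), where `α` is
taken in the frequency variable of Mathlib's Fourier transform. Put `V = f'(φ)`, let `K` be the
operator `𝓛^{-1/2} V 𝓛^{-1/2}` and `D` the operator `𝓛⁻¹`, both conjugated by the Fourier
transform (`IsSymbol.birmanSchwinger`, `IsSymbol.invOp`). In terms of `h`, the equation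
`𝓗₀ v = ν v` reads `h - K h = ν h` (`param_mem_eigenspace_opH₀`), and `𝓗 v = μ v` reads
`h - K h = μ D h` (`param_mem_eigenspace_opH`). So both operators are governed by the same quadratic
form `⟪h - K h, h⟫`, relative to the identity and to the positive operator `D` respectively, and the
claim is that the number of negative eigenvalues does not depend on that choice.

The operator `K` is symmetric because `V` is real. It is compact because `V 𝓕⁻¹ α^{-1/2}` has the
kernel `V x e^{2πixξ} α(ξ)^{-1/2}`, which is square integrable: `α^{-1/2} ∈ L²` as `s > 1/2`, and
`V ∈ L²` as `|f'(φ)|` is at most a multiple of `|φ|` (`isCompactOperator_mul_fourierInv_mul`).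

For compact `K` the infimum of the form relative to `D`, if negative, is attained at an
eigenvector (`exists_neg_eigenvector`). Relative to the identity, on the complement of the negative
eigenvector `e` of `1 - K`, this shows that the form is nonnegative there
(`nonneg_of_orthogonal`). Relative to `D`, it gives a negative eigenvalue of `𝓗`; here
the form is bounded below relative to `D` because `V` is bounded. Two independent eigenvectors of
`𝓗` with negative eigenvalues would span a plane on which the form is negative, and this plane would
meet the complement of `e` (`HypH1.of_compact`).

The kernels of `𝓗₀` and `𝓗` coincide since `𝓛` is invertible.
-/

noncomputable section

namespace SolitaryWave

open scoped InnerProductSpace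
open Filter Topology

/-! ### Pencils `1 - K - μ D` with `K` compact -/

section abstract

variable {E : Type*} [NormedAddCommGroup E] [InnerProductSpace ℂ E]

/-- For a symmetric `S ≥ 0` the vector `S h` is controlled by the value of the form at `h`, by
positivity of the form at `h - t S h` for a small real `t`. -/
theorem norm_sq_apply_le_of_nonneg {S : E →L[ℂ] E} (hS : (S : E →ₗ[ℂ] E).IsSymmetric)
    (hpos : ∀ h, 0 ≤ (⟪S h, h⟫_ℂ).re) (h : E) :
    ‖S h‖ ^ 2 ≤ (‖S‖ + 1) * (⟪S h, h⟫_ℂ).re := by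
  set t : ℝ := (‖S‖ + 1)⁻¹ with ht
  have hn : 0 < ‖S‖ + 1 := by positivity
  have ht0 : 0 < t := by positivity
  have h1 := hpos (h - (t : ℂ) • S h)
  have h2 : (⟪S (S h), h⟫_ℂ) = ⟪S h, S h⟫_ℂ := hS (S h) h
  have h3 : (⟪S (S h), S h⟫_ℂ).re ≤ ‖S‖ * ‖S h‖ ^ 2 := by
    refine (Complex.re_le_norm _).trans ((norm_inner_le_norm _ _).trans ?_)
    nlinarith [S.le_opNorm (S h), norm_nonneg (S h)]
  have h4 : (⟪S h, S h⟫_ℂ).re = ‖S h‖ ^ 2 := by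
    simpa using inner_self_eq_norm_sq (𝕜 := ℂ) (S h)
  have h5 : (⟪S h, h⟫_ℂ).re - 2 * t * ‖S h‖ ^ 2 + t ^ 2 * (⟪S (S h), S h⟫_ℂ).re =
      (⟪S (h - (t : ℂ) • S h), h - (t : ℂ) • S h⟫_ℂ).re := by
    simp only [map_sub, map_smul, inner_sub_left, inner_sub_right, inner_smul_left,
      inner_smul_right, h2, Complex.conj_ofReal, Complex.sub_re, Complex.re_ofReal_mul, h4]
    ring
  rw [← h5] at h1
  have h6 : t * ‖S‖ ≤ 1 := by
    rw [ht, inv_mul_le_iff₀ hn]; linarith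
  have h7 : t ^ 2 * (⟪S (S h), S h⟫_ℂ).re ≤ t * ‖S h‖ ^ 2 := by
    calc _ ≤ t ^ 2 * (‖S‖ * ‖S h‖ ^ 2) := by gcongr
      _ = t * (t * ‖S‖) * ‖S h‖ ^ 2 := by ring
      _ ≤ t * 1 * ‖S h‖ ^ 2 := by gcongr
      _ = _ := by ring
  have h8 : t * ‖S h‖ ^ 2 ≤ (⟪S h, h⟫_ℂ).re := by linarith
  rwa [ht, inv_mul_le_iff₀ hn] at h8

/-- If `P ≥ 1`, `K` is compact and `P - K ≥ 0` is not coercive, then `P - K` has a kernel: along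
unit vectors `h n` at which the form tends to `0`, `(P - K) (h n)` tends to `0`, so that compactness
of `K` and the lower bound on `P` make a subsequence of `h n` converge. -/
theorem exists_ker_of_not_coercive [CompleteSpace E] {P K : E →L[ℂ] E}
    (hK : IsCompactOperator K) (hS : ((P - K : E →L[ℂ] E) : E →ₗ[ℂ] E).IsSymmetric)
    (hP : ∀ h, ‖h‖ ^ 2 ≤ (⟪P h, h⟫_ℂ).re)
    (hpos : ∀ h, 0 ≤ (⟪(P - K) h, h⟫_ℂ).re)
    (hc : ∀ c > 0, ∃ h, (⟪(P - K) h, h⟫_ℂ).re < c * ‖h‖ ^ 2) :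
    ∃ h ≠ 0, P h = K h := by
  have hnorm : ∀ c > 0, ∃ h, ‖h‖ = 1 ∧ (⟪(P - K) h, h⟫_ℂ).re < c := by
    intro c hc0
    obtain ⟨h, hh⟩ := hc c hc0
    have h0 : h ≠ 0 := by
      rintro rfl
      simp at hh
    have hn : 0 < ‖h‖ := norm_pos_iff.2 h0
    refine ⟨((‖h‖⁻¹ : ℝ) : ℂ) • h, ?_, ?_⟩
    · rw [norm_smul, Complex.norm_real, norm_inv, norm_norm, inv_mul_cancel₀ hn.ne']
    · simp only [map_smul, inner_smul_left, inner_smul_right, Complex.conj_ofReal,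
        Complex.re_ofReal_mul]
      rw [← mul_assoc, ← mul_inv, inv_mul_lt_iff₀ (by positivity)]
      nlinarith
  choose h hh1 hh2 using fun n : ℕ => hnorm (1 / ((n : ℝ) + 1)) (by positivity)
  have hSh : Tendsto (fun n => (P - K) (h n)) atTop (𝓝 0) := by
    rw [tendsto_zero_iff_norm_tendsto_zero]
    have h1 : Tendsto (fun n : ℕ => (‖P - K‖ + 1) * (1 / ((n : ℝ) + 1))) atTop (𝓝 0) := by
      simpa using tendsto_one_div_add_atTop_nhds_zero_nat.const_mul (‖P - K‖ + 1)
    have h2 : Tendsto (fun n => ‖(P - K) (h n)‖ ^ 2) atTop (𝓝 0) :=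
      squeeze_zero (fun n => by positivity) (fun n =>
        (norm_sq_apply_le_of_nonneg hS hpos (h n)).trans (by gcongr; exact (hh2 n).le)) h1
    simpa [Real.sqrt_sq] using h2.sqrt
  have hcpt := hK.isCompact_closure_image_closedBall (f := (K : E →ₗ[ℂ] E)) 1
  obtain ⟨k, -, σ, hσ, hk⟩ := hcpt.tendsto_subseq (x := fun n => K (h n))
    (fun n => subset_closure ⟨h n, by simp [hh1], rfl⟩)
  have hPh : Tendsto (fun n => P (h (σ n))) atTop (𝓝 k) := by
    have := (hSh.comp hσ.tendsto_atTop).add hk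
    simpa [Function.comp_def] using this
  have hanti : AntilipschitzWith 1 P := by
    refine P.antilipschitz_of_bound fun x => ?_
    rcases eq_or_ne x 0 with rfl | hx
    · simp
    · have h1 : ‖x‖ ^ 2 ≤ ‖P x‖ * ‖x‖ :=
        (hP x).trans ((Complex.re_le_norm _).trans (norm_inner_le_norm _ _))
      have h2 : 0 < ‖x‖ := norm_pos_iff.2 hx
      rw [NNReal.coe_one, one_mul]
      nlinarith
  have hcau : CauchySeq (fun n => h (σ n)) := by
    exact (hanti.isUniformInducing P.uniformContinuous).cauchy_map_iff.1 hPh.cauchySeq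
  obtain ⟨x, hx⟩ := cauchySeq_tendsto_of_complete hcau
  refine ⟨x, ?_, ?_⟩
  · rintro rfl
    have := hx.norm
    simp [hh1] at this
  · have h1 := (P.continuous.tendsto x).comp hx
    have h2 := (K.continuous.tendsto x).comp hx
    exact (tendsto_nhds_unique h1 hPh).trans (tendsto_nhds_unique h2 hk).symm

/-- Existence of a negative eigenvalue of `1 - K` relative to `D ≥ 0`. It is the infimum `μ` of the
quotient of the forms of `1 - K` and `D`: the nonnegative form of `1 - μ D - K` cannot be coercive,
since otherwise `μ` could be increased. -/
theorem exists_neg_eigenvector [CompleteSpace E] {K D : E →L[ℂ] E}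
    (hK : IsCompactOperator K) (hKs : (K : E →ₗ[ℂ] E).IsSymmetric)
    (hDs : (D : E →ₗ[ℂ] E).IsSymmetric) (hD : ∀ h, 0 ≤ (⟪D h, h⟫_ℂ).re)
    {C : ℝ} (hC : ∀ h, (⟪K h, h⟫_ℂ).re ≤ ‖h‖ ^ 2 + C * (⟪D h, h⟫_ℂ).re)
    (hneg : ∃ h, ‖h‖ ^ 2 < (⟪K h, h⟫_ℂ).re) :
    ∃ μ : ℝ, μ < 0 ∧ ∃ h ≠ 0, h - K h = (μ : ℂ) • D h := by
  obtain ⟨h₀, hh₀⟩ := hneg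
  -- `M` is the set of lower bounds of the quotient; this form of the condition needs no division
  -- by `⟪D h, h⟫`, which may vanish.
  set M : Set ℝ := {t | ∀ h, t * (⟪D h, h⟫_ℂ).re ≤ ‖h‖ ^ 2 - (⟪K h, h⟫_ℂ).re} with hM
  have hd₀ : 0 < (⟪D h₀, h₀⟫_ℂ).re := by
    refine (hD h₀).lt_of_ne' fun h => ?_
    have := hC h₀
    rw [h] at this
    linarith
  have hne : M.Nonempty := ⟨-C, fun h => by linarith [hC h]⟩
  have hub : ∀ t ∈ M, t ≤ (‖h₀‖ ^ 2 - (⟪K h₀, h₀⟫_ℂ).re) / (⟪D h₀, h₀⟫_ℂ).re := fun t ht =>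
    (le_div_iff₀ hd₀).2 (ht h₀)
  have hbdd : BddAbove M := ⟨_, hub⟩
  set μ := sSup M with hμ
  have hμneg : μ < 0 := (csSup_le hne hub).trans_lt (div_neg_of_neg_of_pos (by linarith) hd₀)
  have hμM : μ ∈ M := by
    have hcl : IsClosed M := by
      simp only [hM, Set.ofPred_forall]
      exact isClosed_iInter fun h => isClosed_le (by fun_prop) (by fun_prop)
    exact hcl.csSup_mem hne hbdd
  have hS : ∀ h, (⟪((1 - (μ : ℂ) • D) - K) h, h⟫_ℂ).re =
      ‖h‖ ^ 2 - (⟪K h, h⟫_ℂ).re - μ * (⟪D h, h⟫_ℂ).re := by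
    intro h
    have h4 : (⟪h, h⟫_ℂ).re = ‖h‖ ^ 2 := by
      simpa using inner_self_eq_norm_sq (𝕜 := ℂ) h
    simp only [sub_apply, smul_apply,
      one_apply_eq_self, inner_sub_left, inner_smul_left, Complex.conj_ofReal,
      Complex.sub_re, Complex.re_ofReal_mul, h4]
    ring
  obtain ⟨h, hh, hhe⟩ := exists_ker_of_not_coercive (P := 1 - (μ : ℂ) • D) hK
    (fun x y => by
      have h1 := hKs x y
      have h2 := hDs x y
      simp only [ContinuousLinearMap.coe_coe] at h1 h2
      simp [-Complex.coe_smul, inner_sub_left, inner_sub_right, inner_smul_left,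
        inner_smul_right, h1, h2])
    (fun h => by
      have h1 := hS h
      simp only [sub_apply _ K, inner_sub_left, Complex.sub_re] at h1
      nlinarith [hD h])
    (fun h => by
      rw [hS]
      linarith [hμM h])
    (fun c hc => by
      by_contra! hcon
      have hmem : μ + c / (‖D‖ + 1) ∈ M := by
        intro h
        have h1 := hcon h
        rw [hS] at h1
        have h2 : (⟪D h, h⟫_ℂ).re ≤ (‖D‖ + 1) * ‖h‖ ^ 2 := by
          refine (Complex.re_le_norm _).trans ((norm_inner_le_norm _ _).trans ?_)
          nlinarith [D.le_opNorm h, norm_nonneg h]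
        have h3 : c / (‖D‖ + 1) * (⟪D h, h⟫_ℂ).re ≤ c * ‖h‖ ^ 2 := by
          calc _ ≤ c / (‖D‖ + 1) * ((‖D‖ + 1) * ‖h‖ ^ 2) := by gcongr
            _ = _ := by field_simp
        linarith
      have h4 := le_csSup hbdd hmem
      have h5 : 0 < c / (‖D‖ + 1) := by positivity
      linarith)
  refine ⟨μ, hμneg, h, hh, ?_⟩
  rw [← hhe]
  simp

/-- If all eigenvectors of `1 - K` with negative eigenvalue lie on one line `ℂ ∙ e`, then the form of
`1 - K` is nonnegative on the orthogonal complement of `e`; that is, it has negative index at most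
one. -/
theorem nonneg_of_orthogonal [CompleteSpace E] {K : E →L[ℂ] E}
    (hK : IsCompactOperator K) (hKs : (K : E →ₗ[ℂ] E).IsSymmetric) {e : E} {ν : ℂ}
    (he : K e = ν • e) (hspan : ∀ (μ : ℝ) (h : E), μ < 0 → h - K h = (μ : ℂ) • h → h ∈ ℂ ∙ e)
    {h : E} (hh : ⟪e, h⟫_ℂ = 0) : (⟪K h, h⟫_ℂ).re ≤ ‖h‖ ^ 2 := by
  by_contra! hneg
  have hinv : ∀ x ∈ (ℂ ∙ e)ᗮ, (K : E →ₗ[ℂ] E) x ∈ (ℂ ∙ e)ᗮ := by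
    intro x hx
    rw [Submodule.mem_orthogonal_singleton_iff_inner_right] at hx ⊢
    rw [← hKs e x]
    simp [he, inner_smul_left, hx]
  set K' : (ℂ ∙ e)ᗮ →L[ℂ] (ℂ ∙ e)ᗮ :=
    ⟨(K : E →ₗ[ℂ] E).restrict hinv, K.continuous.restrict hinv⟩ with hK'
  have hKv : ∀ x : (ℂ ∙ e)ᗮ, ((K' x : (ℂ ∙ e)ᗮ) : E) = K x := fun x => rfl
  obtain ⟨μ, hμ, x, hx, hxe⟩ := exists_neg_eigenvector (K := K') (D := 1) (C := ‖K'‖)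
    (hK.restrict' hinv)
    (fun x y => by
      have := hKs x y
      simpa [hKv] using this)
    (fun x y => by simp) (fun x => by
      simpa using inner_self_nonneg (𝕜 := ℂ) (x := x)) (fun x => by
      have h4 : (⟪x, x⟫_ℂ).re = ‖x‖ ^ 2 := by
        simpa using inner_self_eq_norm_sq (𝕜 := ℂ) x
      rw [one_apply_eq_self, h4]
      refine (Complex.re_le_norm _).trans ((norm_inner_le_norm _ _).trans ?_)
      nlinarith [K'.le_opNorm x, norm_nonneg x, sq_nonneg ‖x‖])
    ⟨⟨h, Submodule.mem_orthogonal_singleton_iff_inner_right.2 hh⟩, by simpa [hKv] using hneg⟩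
  have h1 : (x : E) ∈ ℂ ∙ e := by
    refine hspan μ x hμ ?_
    have := congrArg (Subtype.val) hxe
    simpa [hKv] using this
  apply hx
  apply Subtype.ext
  have := (Submodule.mem_orthogonal _ _).1 x.2 x h1
  simpa using this

theorem mem_eigenspace_iff {V W : Type*} [AddCommGroup V] [Module ℂ V] [AddCommGroup W]
    [Module ℂ W] {j A : V →ₗ[ℂ] W} {μ : ℝ} {v : V} :
    v ∈ eigenspace j A μ ↔ A v = (μ : ℂ) • j v := by
  simp [eigenspace, sub_eq_zero]

/-- A single simple negative eigenvalue of `1 - K` forces a single simple negative eigenvalue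
relative to `D > 0`. With `e` the negative eigenvector of `1 - K`, no nonzero vector orthogonal to
`e` has a negative value of the form, whereas two independent relative eigenvectors would have a
nonzero combination orthogonal to `e` with a negative value. -/
theorem HypH1.of_compact [CompleteSpace E] {K D : E →L[ℂ] E}
    (hK : IsCompactOperator K) (hKs : (K : E →ₗ[ℂ] E).IsSymmetric)
    (hDs : (D : E →ₗ[ℂ] E).IsSymmetric) (hD : ∀ h ≠ 0, 0 < (⟪D h, h⟫_ℂ).re)
    {C : ℝ} (hC : ∀ h, (⟪K h, h⟫_ℂ).re ≤ ‖h‖ ^ 2 + C * (⟪D h, h⟫_ℂ).re)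
    (h1 : HypH1 LinearMap.id ((1 - K : E →L[ℂ] E) : E →ₗ[ℂ] E)) :
    HypH1 (D : E →ₗ[ℂ] E) ((1 - K : E →L[ℂ] E) : E →ₗ[ℂ] E) := by
  obtain ⟨ν, hν, hfin, huniq⟩ := h1
  obtain ⟨⟨e, heE⟩, hene, hspan⟩ := finrank_eq_one_iff'.1 hfin
  have he0 : e ≠ 0 := fun h => hene (Subtype.ext h)
  have he : e - K e = (ν : ℂ) • e := by simpa using mem_eigenspace_iff.1 heE
  have hKe : K e = (1 - ν : ℂ) • e := by
    rw [sub_smul, one_smul, ← he]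
    abel
  have hq : ∀ {h : E}, ⟪e, h⟫_ℂ = 0 → (⟪K h, h⟫_ℂ).re ≤ ‖h‖ ^ 2 := by
    refine nonneg_of_orthogonal hK hKs hKe fun μ h hμ hh => ?_
    have hmem : h ∈ eigenspace LinearMap.id ((1 - K : E →L[ℂ] E) : E →ₗ[ℂ] E) μ :=
      mem_eigenspace_iff.2 (by simpa using hh)
    rcases eq_or_ne h 0 with rfl | h0
    · exact Submodule.zero_mem _
    · obtain rfl := huniq μ hμ fun hbot => h0 ((Submodule.eq_bot_iff _).1 hbot h hmem)
      obtain ⟨c, hc⟩ := hspan ⟨h, hmem⟩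
      exact Submodule.mem_span_singleton.2 ⟨c, congrArg Subtype.val hc⟩
  have hself : ∀ h : E, (⟪h, h⟫_ℂ).re = ‖h‖ ^ 2 := fun h => by
    simpa using inner_self_eq_norm_sq (𝕜 := ℂ) h
  -- The form is negative at relative eigenvectors, which therefore are not orthogonal to `e`.
  have hval : ∀ {μ : ℝ} {h : E}, h - K h = (μ : ℂ) • D h →
      ‖h‖ ^ 2 - (⟪K h, h⟫_ℂ).re = μ * (⟪D h, h⟫_ℂ).re := by
    intro μ h hh
    have := congrArg (fun z => (⟪z, h⟫_ℂ).re) hh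
    simpa only [inner_sub_left, inner_smul_left, Complex.sub_re, hself, Complex.conj_ofReal,
      Complex.re_ofReal_mul] using this
  have hnorth : ∀ {μ : ℝ} {h : E}, μ < 0 → h - K h = (μ : ℂ) • D h → ⟪e, h⟫_ℂ = 0 → h = 0 := by
    intro μ h hμ hh h0
    by_contra hne
    have := hval hh
    nlinarith [hq h0, hD h hne]
  obtain ⟨μ, hμ, x, hx0, hx⟩ := exists_neg_eigenvector hK hKs hDs
    (fun h => by
      rcases eq_or_ne h 0 with rfl | h0
      · simp
      · exact (hD h h0).le) hC ⟨e, by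
      rw [hKe, inner_smul_left]
      have : ((starRingEnd ℂ) (1 - (ν : ℂ))) = ((1 - ν : ℝ) : ℂ) := by simp
      rw [this, Complex.re_ofReal_mul, hself]
      have : 0 < ‖e‖ ^ 2 := by positivity
      nlinarith⟩
  refine ⟨μ, hμ, ?_, fun μ' hμ' hbot => ?_⟩
  · refine finrank_eq_one_iff'.2 ⟨⟨x, mem_eigenspace_iff.2 (by simpa using hx)⟩,
      fun h => hx0 (congrArg Subtype.val h), fun ⟨y, hy⟩ => ?_⟩
    have hy' : y - K y = (μ : ℂ) • D y := by simpa using mem_eigenspace_iff.1 hy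
    have hex : ⟪e, x⟫_ℂ ≠ 0 := fun h => hx0 (hnorth hμ hx h)
    refine ⟨⟪e, y⟫_ℂ / ⟪e, x⟫_ℂ, Subtype.ext ?_⟩
    set c := ⟪e, y⟫_ℂ / ⟪e, x⟫_ℂ with hc
    have : y - c • x = 0 := by
      refine hnorth hμ ?_ ?_
      · rw [map_sub, map_sub, map_smul, map_smul, smul_sub, ← hy', smul_comm, ← hx, smul_sub]
        abel
      · rw [inner_sub_right, inner_smul_right, hc, div_mul_cancel₀ _ hex, sub_self]
    exact (sub_eq_zero.1 this).symm
  · obtain ⟨y, hy, hy0⟩ := Submodule.exists_mem_ne_zero_of_ne_bot hbot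
    have hy' : y - K y = (μ' : ℂ) • D y := by simpa using mem_eigenspace_iff.1 hy
    by_contra hne
    have hex : ⟪e, x⟫_ℂ ≠ 0 := fun h => hx0 (hnorth hμ hx h)
    have hKs' : ∀ u v, ⟪K u, v⟫_ℂ = ⟪u, K v⟫_ℂ := hKs
    have hDs' : ∀ u v, ⟪D u, v⟫_ℂ = ⟪u, D v⟫_ℂ := hDs
    -- Eigenvectors for distinct eigenvalues are `D`-orthogonal, so that the form is diagonal on
    -- their span.
    have hDxy : ⟪D x, y⟫_ℂ = 0 := by
      have e1 := congrArg (fun z => ⟪z, y⟫_ℂ) hx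
      have e2 := congrArg (fun z => ⟪x, z⟫_ℂ) hy'
      simp only [inner_sub_left, inner_sub_right, inner_smul_left, inner_smul_right,
        Complex.conj_ofReal, hKs', ← hDs'] at e1 e2
      have e3 : ((μ : ℂ) - μ') * ⟪D x, y⟫_ℂ = 0 := by linear_combination e2 - e1
      refine (mul_eq_zero.1 e3).resolve_left fun h => hne ?_
      exact_mod_cast (sub_eq_zero.1 h).symm
    have hDyx : ⟪D y, x⟫_ℂ = 0 := by
      rw [hDs', ← inner_conj_symm, hDxy, map_zero]
    set a := ⟪e, y⟫_ℂ with ha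
    set b := ⟪e, x⟫_ℂ with hb
    have hz := hq (h := a • x - b • y) (by
      rw [inner_sub_right, inner_smul_right, inner_smul_right, ← ha, ← hb]
      ring)
    have hAz : (a • x - b • y) - K (a • x - b • y) =
        (a * μ) • D x - (b * μ') • D y := by
      rw [map_sub, map_smul, map_smul, mul_smul, mul_smul, ← hx, ← hy', smul_sub, smul_sub]
      abel
    have hform := congrArg (fun z => (⟪z, a • x - b • y⟫_ℂ).re) hAz
    have haux : ∀ (c : ℂ) (m : ℝ) (w : ℂ), (c * ((starRingEnd ℂ) (c * m) * w)).re =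
        ‖c‖ ^ 2 * m * w.re := by
      intro c m w
      rw [← Complex.normSq_eq_norm_sq, Complex.normSq_apply]
      simp
      ring
    have hR : (⟪(a * μ) • D x - (b * μ') • D y, a • x - b • y⟫_ℂ).re =
        ‖a‖ ^ 2 * μ * (⟪D x, x⟫_ℂ).re + ‖b‖ ^ 2 * μ' * (⟪D y, y⟫_ℂ).re := by
      simp only [inner_sub_left, inner_sub_right, inner_smul_left, inner_smul_right, hDxy, hDyx,
        mul_zero, sub_zero, zero_sub, mul_neg, sub_neg_eq_add, Complex.add_re, haux]
    rw [hR, inner_sub_left, Complex.sub_re, hself] at hform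
    have hx1 := hD x hx0
    have hy1 := hD y hy0
    have hb0 : 0 < ‖b‖ ^ 2 := by positivity
    have t1 : ‖a‖ ^ 2 * μ * (⟪D x, x⟫_ℂ).re ≤ 0 :=
      mul_nonpos_of_nonpos_of_nonneg (mul_nonpos_of_nonneg_of_nonpos (by positivity) hμ.le) hx1.le
    have t2 : ‖b‖ ^ 2 * μ' * (⟪D y, y⟫_ℂ).re < 0 :=
      mul_neg_of_neg_of_pos (mul_neg_of_pos_of_neg hb0 hμ') hy1
    linarith

end abstract

/-! ### Hilbert–Schmidt operators into `L²` -/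

section compactness
variable {E : Type*} [NormedAddCommGroup E] [NormedSpace ℂ E]
variable {X : Type*} [MeasurableSpace X] {m : Measure X}

/-- The operator `h ↦ (x ↦ G x h)` given by a square integrable field `G` of functionals. -/
def fieldOp : Lp (E →L[ℂ] ℂ) 2 m →L[ℂ] E →L[ℂ] Lp ℂ 2 m :=
  LinearMap.mkContinuous₂
    (LinearMap.mk₂ ℂ (fun G h => (ContinuousLinearMap.apply ℂ ℂ h).compLp G)
      (fun G G' h => ((ContinuousLinearMap.apply ℂ ℂ h).compLpL 2 m).map_add G G')
      (fun c G h => ((ContinuousLinearMap.apply ℂ ℂ h).compLpL 2 m).map_smul c G)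
      (fun G h h' => by rw [map_add, ContinuousLinearMap.add_compLp])
      (fun c G h => by rw [map_smul, ContinuousLinearMap.smul_compLp])) 1
    (fun G h => by
      rw [one_mul, mul_comm]
      refine (ContinuousLinearMap.norm_compLp_le _ _).trans ?_
      gcongr
      exact ContinuousLinearMap.opNorm_le_bound _ (norm_nonneg _) fun l => by
        rw [mul_comm]
        exact l.le_opNorm h)

theorem coeFn_fieldOp (G : Lp (E →L[ℂ] ℂ) 2 m) (h : E) :
    fieldOp G h =ᵐ[m] fun x => G x h :=
  ContinuousLinearMap.coeFn_compLp (ContinuousLinearMap.apply ℂ ℂ h) G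

/-- Square integrable fields are `L²` limits of simple ones, which give operators of finite rank. -/
theorem isCompactOperator_fieldOp (G : Lp (E →L[ℂ] ℂ) 2 m) :
    IsCompactOperator (fieldOp G) := by
  induction G using Lp.induction (p := 2) ENNReal.ofNat_ne_top with
  | indicatorConst c hs hm =>
    rename_i t
    have hfac : fieldOp (Lp.simpleFunc.indicatorConst 2 hs hm.ne c : Lp (E →L[ℂ] ℂ) 2 m) =
        (ContinuousLinearMap.toSpanSingleton ℂ (indicatorConstLp 2 hs hm.ne (1 : ℂ))) ∘L c := by
      ext1 h
      apply Lp.ext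
      rw [ContinuousLinearMap.comp_apply, ContinuousLinearMap.toSpanSingleton_apply]
      filter_upwards [coeFn_fieldOp (Lp.simpleFunc.indicatorConst 2 hs hm.ne c) h,
        indicatorConstLp_coeFn (p := 2) (hs := hs) (hμs := hm.ne) (c := c),
        indicatorConstLp_coeFn (p := 2) (hs := hs) (hμs := hm.ne) (c := (1 : ℂ)),
        Lp.coeFn_smul (c h) (indicatorConstLp 2 hs hm.ne (1 : ℂ))] with x h1 h2 h3 h4
      rw [h1, h4, Lp.simpleFunc.coe_indicatorConst, h2, Pi.smul_apply, h3]
      by_cases hx : x ∈ t <;> simp [hx]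
    rw [hfac]
    exact (isCompactOperator_of_locallyCompactSpace_rng
      (ContinuousLinearMap.toSpanSingleton ℂ (indicatorConstLp 2 hs hm.ne (1 : ℂ)))).comp_clm c
  | add hf hg _ h1 h2 =>
    rw [map_add]
    exact h1.add h2
  | isClosed =>
    exact isClosed_setOfPred_isCompactOperator.preimage (fieldOp (E := E) (m := m)).continuous
end compactness

/-! ### Multiplication operators on `L²(ℝ)` -/

/-- The Hilbert space `L²(ℝ; ℂ)`. -/
abbrev L2R : Type := Lp ℂ 2 (volume : Measure ℝ)

/-- Multiplication by a bounded function `a`, as an operator on `L²(ℝ)`. -/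
def mulOp {a : ℝ → ℂ} (ha : MemLp a ∞ volume) :
    L2R →L[ℂ] L2R :=
  (ContinuousLinearMap.mul ℂ ℂ).holderL volume ∞ 2 2 ha.toLp

theorem coeFn_mulOp {a : ℝ → ℂ} (ha : MemLp a ∞ volume) (h : L2R) :
    mulOp ha h =ᵐ[volume] fun x => a x * h x := by
  filter_upwards [(ContinuousLinearMap.mul ℂ ℂ).coeFn_holder (r := 2) ha.toLp h,
    ha.coeFn_toLp] with x h1 h2
  rw [h2] at h1
  exact h1

theorem inner_mulOp {a : ℝ → ℝ} (ha : MemLp (fun x => (a x : ℂ)) ∞ volume)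
    (g h : L2R) : ⟪mulOp ha g, h⟫_ℂ = ⟪g, mulOp ha h⟫_ℂ := by
  rw [L2.inner_def, L2.inner_def]
  refine integral_congr_ae ?_
  filter_upwards [coeFn_mulOp ha g, coeFn_mulOp ha h] with x h1 h2
  simp only [h1, h2, RCLike.inner_apply, map_mul, Complex.conj_ofReal]
  ring

theorem represents_mulOp {a : ℝ → ℂ} (ha : MemLp a ∞ volume) (h : L2R) :
    Represents (mulOp ha h : 𝓢'(ℝ, ℂ)) (fun x => a x * h x) :=
  (represents_lp _).congr (coeFn_mulOp ha h)

/-! ### Compactness of `V 𝓕⁻¹ b` for square integrable `V` and `b` -/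

/-- A tempered distribution whose Fourier transform is integrable is the function given by the
inverse Fourier integral. -/
theorem represents_fourierInv {T : 𝓢'(ℝ, ℂ)} {g : ℝ → ℂ} (h : Represents (𝓕 T) g)
    (hint : Integrable g volume) : Represents T (𝓕⁻ g) := by
  have hcont : Continuous (𝓕⁻ g) :=
    VectorFourier.fourierIntegral_continuous Real.continuous_fourierChar
      (L := -innerₗ ℝ) (by fun_prop) hint
  have hbd : ∀ x, ‖𝓕⁻ g x‖ ≤ ∫ ξ, ‖g ξ‖ := fun x =>
    VectorFourier.norm_fourierIntegral_le_integral_norm _ _ (-innerₗ ℝ) _ x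
  refine ⟨hcont.aestronglyMeasurable, fun ψ => ⟨?_, ?_⟩⟩
  · exact ψ.integrable.mul_bdd hcont.aestronglyMeasurable (Filter.Eventually.of_forall hbd)
  · have h1 : T ψ = (𝓕 T) (𝓕⁻ ψ) := by simp
    rw [h1, (h.2 _).2]
    have h2 := VectorFourier.integral_fourierIntegral_smul_eq_flip (μ := volume) (ν := volume)
      (L := -innerₗ ℝ) (f := (ψ : ℝ → ℂ)) (g := g) Real.continuous_fourierChar
      (by fun_prop) ψ.integrable hint
    have h3 : (-innerₗ ℝ).flip = -innerₗ ℝ := by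
      ext
      simp
    rw [h3] at h2
    simp only [smul_eq_mul, SchwartzMap.fourierInv_coe] at h2 ⊢
    exact h2

/-- The function `ξ ↦ e^{-2πixξ} b ξ`, whose inner product with `h` is the inverse Fourier integral
of `b h` at `x`. -/
def modulate (b : ℝ → ℝ) (x ξ : ℝ) : ℂ :=
  Complex.exp (↑(-(2 * Real.pi * (ξ * x))) * Complex.I) * b ξ

theorem norm_modulate (b : ℝ → ℝ) (x ξ : ℝ) : ‖modulate b x ξ‖ = ‖(b ξ : ℂ)‖ := by
  rw [modulate, norm_mul, Complex.norm_exp_ofReal_mul_I, one_mul]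

theorem memLp_modulate {b : ℝ → ℝ} (hb : MemLp (fun ξ => (b ξ : ℂ)) 2 volume) (x : ℝ) :
    MemLp (modulate b x) 2 volume :=
  hb.of_le ((by fun_prop : Continuous fun ξ : ℝ =>
    Complex.exp (↑(-(2 * Real.pi * (ξ * x))) * Complex.I)).aestronglyMeasurable.mul hb.1)
    (Eventually.of_forall fun ξ => (norm_modulate b x ξ).le)

theorem continuous_modulate {b : ℝ → ℝ} (hb : MemLp (fun ξ => (b ξ : ℂ)) 2 volume) :
    Continuous fun x => (memLp_modulate hb x).toLp := by
  refine continuous_iff_continuousAt.2 fun y => ?_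
  rw [ContinuousAt, tendsto_iff_norm_sub_tendsto_zero]
  have hsq : ∀ x, ‖(memLp_modulate hb x).toLp - (memLp_modulate hb y).toLp‖ ^ 2 =
      ∫ ξ, ‖modulate b x ξ - modulate b y ξ‖ ^ 2 := by
    intro x
    have h1 := inner_self_eq_norm_sq (𝕜 := ℂ)
      ((memLp_modulate hb x).toLp - (memLp_modulate hb y).toLp)
    rw [← h1, L2.inner_def]
    have h2 : ∫ ξ, ⟪((memLp_modulate hb x).toLp - (memLp_modulate hb y).toLp : L2R) ξ,
        ((memLp_modulate hb x).toLp - (memLp_modulate hb y).toLp : L2R) ξ⟫_ℂ =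
        ∫ ξ, ((‖modulate b x ξ - modulate b y ξ‖ ^ 2 : ℝ) : ℂ) := by
      refine integral_congr_ae ?_
      filter_upwards [Lp.coeFn_sub (memLp_modulate hb x).toLp (memLp_modulate hb y).toLp,
        (memLp_modulate hb x).coeFn_toLp, (memLp_modulate hb y).coeFn_toLp] with ξ h3 h4 h5
      rw [h3, Pi.sub_apply, h4, h5, inner_self_eq_norm_sq_to_K]
      push_cast
      rfl
    rw [h2, integral_complex_ofReal]
    rfl
  have hcont : Continuous fun x => ∫ ξ, ‖modulate b x ξ - modulate b y ξ‖ ^ 2 := by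
    refine continuous_of_dominated (bound := fun ξ => 4 * ‖(b ξ : ℂ)‖ ^ 2) (fun x => ?_)
      (fun x => Eventually.of_forall fun ξ => ?_) ?_ (Eventually.of_forall fun ξ => ?_)
    · exact ((memLp_modulate hb x).1.sub (memLp_modulate hb y).1).norm.pow 2
    · have := norm_sub_le (modulate b x ξ) (modulate b y ξ)
      rw [norm_modulate, norm_modulate] at this
      rw [Real.norm_of_nonneg (by positivity)]
      calc _ ≤ (‖(b ξ : ℂ)‖ + ‖(b ξ : ℂ)‖) ^ 2 := by gcongr
        _ = _ := by ring
    · exact ((memLp_two_iff_integrable_sq_norm hb.1).1 hb).const_mul 4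
    · unfold modulate
      fun_prop
  have h0 := hcont.tendsto y
  simp only [sub_self, norm_zero, ne_eq, OfNat.ofNat_ne_zero, not_false_eq_true, zero_pow,
    integral_zero, ← hsq] at h0
  simpa [Real.sqrt_sq] using h0.sqrt

/-- The operator `h ↦ V 𝓕⁻¹ (b h)` has the square integrable kernel `V x e^{2πixξ} b ξ`. -/
theorem isCompactOperator_mul_fourierInv_mul {V : ℝ → ℂ} {b : ℝ → ℝ} (hV : MemLp V ∞ volume)
    (hV2 : MemLp V 2 volume) (hb : MemLp (fun ξ => (b ξ : ℂ)) ∞ volume)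
    (hb2 : MemLp (fun ξ => (b ξ : ℂ)) 2 volume) :
    IsCompactOperator fun h : L2R =>
      mulOp hV ((Lp.fourierTransformₗᵢ ℝ ℂ).symm (mulOp hb h)) := by
  set κ : ℝ → (L2R →L[ℂ] ℂ) := fun x =>
    innerSL ℂ (memLp_modulate hb2 x).toLp with hκ
  have hκc : Continuous κ := (innerSL ℂ).continuous.comp (continuous_modulate hb2)
  have hG : MemLp (fun x => V x • κ x) 2 volume := by
    refine hV2.of_le_mul (c := (eLpNorm (fun ξ => (b ξ : ℂ)) 2 volume).toReal)
      (hV2.1.smul hκc.aestronglyMeasurable) (Eventually.of_forall fun x => ?_)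
    rw [norm_smul, mul_comm, hκ, innerSL_apply_norm, Lp.norm_toLp]
    rw [eLpNorm_congr_norm_ae (Eventually.of_forall (norm_modulate b x))]
  suffices hfun : (fun h : L2R =>
      mulOp hV ((Lp.fourierTransformₗᵢ ℝ ℂ).symm (mulOp hb h))) = fieldOp hG.toLp by
    rw [hfun]
    exact isCompactOperator_fieldOp _
  funext h
  apply Lp.ext
  set w := (Lp.fourierTransformₗᵢ ℝ ℂ).symm (mulOp hb h) with hw
  have hint : Integrable (fun ξ => (b ξ : ℂ) * h ξ) volume := hb2.integrable_mul (Lp.memLp h)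
  have hrep : Represents (𝓕 (w : 𝓢'(ℝ, ℂ))) (fun ξ => (b ξ : ℂ) * h ξ) := by
    rw [Lp.fourier_toTemperedDistribution_eq]
    have : (𝓕 w : L2R) = mulOp hb h :=
      (Lp.fourierTransformₗᵢ ℝ ℂ).apply_symm_apply _
    rw [this]
    exact represents_mulOp hb h
  filter_upwards [coeFn_mulOp hV w, coeFn_fieldOp hG.toLp h, hG.coeFn_toLp,
    (represents_lp w).ae_eq (represents_fourierInv hrep hint)] with x h1 h2 h3 h4
  rw [h1, h2, h3, h4, smul_apply, smul_eq_mul, hκ]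
  congr 1
  rw [innerSL_apply_apply, L2.inner_def, Real.fourierInv_eq']
  refine integral_congr_ae ?_
  filter_upwards [(memLp_modulate hb2 x).coeFn_toLp] with ξ hξ
  have h5 : (inner ℝ ξ x : ℝ) = ξ * x := by simp [mul_comm]
  rw [hξ, h5, RCLike.inner_apply (𝕜 := ℂ), modulate, map_mul, ← Complex.exp_conj]
  simp only [map_mul, Complex.conj_ofReal, Complex.conj_I, smul_eq_mul]
  push_cast
  ring_nf

/-! ### The square root of the inverse symbol -/

/-- `α^{-1/2}`, in the frequency variable of Mathlib's Fourier transform. -/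
def rootInv (α : ℝ → ℝ) (η : ℝ) : ℝ := (√(α (-(2 * Real.pi) * η)))⁻¹

section root
variable {α : ℝ → ℝ} {s : ℝ}

theorem IsSymbol.pos (hα : IsSymbol α s) (ξ : ℝ) : 0 < α ξ := by
  obtain ⟨c₁, c₂, h₁, h₂, h⟩ := hα.bounds
  exact lt_of_lt_of_le (by positivity) (h ξ).1

theorem IsSymbol.rootInv_ne_zero (hα : IsSymbol α s) (η : ℝ) : (rootInv α η : ℂ) ≠ 0 :=
  Complex.ofReal_ne_zero.2 (inv_ne_zero (Real.sqrt_pos.2 (hα.pos _)).ne')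

theorem IsSymbol.symbol_mul_rootInv (hα : IsSymbol α s) (η : ℝ) :
    symbol α η * rootInv α η = (rootInv α η : ℂ)⁻¹ := by
  have h := hα.pos (-(2 * Real.pi) * η)
  rw [symbol, rootInv, ← Complex.ofReal_mul, ← Complex.ofReal_inv, inv_inv]
  congr 1
  rw [← div_eq_mul_inv, Real.div_sqrt]

theorem IsSymbol.norm_rootInv_sq (hα : IsSymbol α s) (η : ℝ) :
    ‖(rootInv α η : ℂ)‖ ^ 2 = ‖(symbol α η)⁻¹‖ := by
  have h := hα.pos (-(2 * Real.pi) * η)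
  rw [symbol, rootInv, Complex.norm_real, Real.norm_of_nonneg (by positivity), inv_pow,
    Real.sq_sqrt h.le, norm_inv, Complex.norm_real, Real.norm_of_nonneg h.le]

theorem norm_weight_sq (q ξ : ℝ) : ‖weight q ξ‖ ^ 2 = ‖weight (2 * q) ξ‖ := by
  rw [sq, ← norm_mul, weight_mul, two_mul]

theorem exists_le_of_sq_le {u v : ℝ → ℝ} (hv : ∀ x, 0 ≤ v x)
    (h : ∃ C, ∀ x, u x ^ 2 ≤ C * v x ^ 2) : ∃ C, ∀ x, u x ≤ C * v x := by
  obtain ⟨C, hC⟩ := h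
  refine ⟨√(max C 0), fun x => ?_⟩
  rw [← Real.sqrt_sq (hv x), ← Real.sqrt_mul (le_max_right _ _)]
  refine Real.le_sqrt_of_sq_le ((hC x).trans ?_)
  gcongr
  exact le_max_left _ _

theorem IsSymbol.norm_rootInv_le (hα : IsSymbol α s) :
    ∃ C, ∀ η, ‖(rootInv α η : ℂ)‖ ≤ C * ‖weight (-s) η‖ := by
  refine exists_le_of_sq_le (fun _ => norm_nonneg _) ?_
  simpa only [hα.norm_rootInv_sq, norm_weight_sq, mul_neg] using hα.norm_inv_symbol_le

theorem IsSymbol.norm_inv_rootInv_le (hα : IsSymbol α s) :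
    ∃ C, ∀ η, ‖(rootInv α η : ℂ)⁻¹‖ ≤ C * ‖weight s η‖ := by
  refine exists_le_of_sq_le (fun _ => norm_nonneg _) ?_
  simpa only [norm_inv, inv_pow, hα.norm_rootInv_sq, norm_weight_sq, inv_inv]
    using hα.norm_symbol_le

theorem IsSymbol.aestronglyMeasurable_rootInv (hα : IsSymbol α s) :
    AEStronglyMeasurable (fun η => (rootInv α η : ℂ)) volume := by
  have h : AEMeasurable (fun η : ℝ => α (-(2 * Real.pi) * η)) volume :=
    hα.aemeasurable.comp_quasiMeasurePreserving
      (Measure.quasiMeasurePreserving_smul volume (neg_ne_zero.2 Real.two_pi_pos.ne'))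
  exact (Complex.measurable_ofReal.comp_aemeasurable h.sqrt.inv).aestronglyMeasurable

/-- This is where `s > 1/2` enters: `|α^{-1/2}|²` decays like `|ξ|^{-2s}`. -/
theorem IsSymbol.memLp_rootInv (hα : IsSymbol α s) :
    MemLp (fun η => (rootInv α η : ℂ)) 2 volume := by
  obtain ⟨C, hC⟩ := hα.norm_rootInv_le
  have hw : MemLp (weight (-s)) 2 volume := by
    refine (memLp_two_iff_integrable_sq_norm
      (weight_hasTemperateGrowth _).1.continuous.aestronglyMeasurable).2 ?_
    have := integrable_rpow_neg_one_add_norm_sq (E := ℝ) (μ := volume) (r := 2 * s)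
      (by simpa using (by linarith [hα.half_lt] : 1 < 2 * s))
    refine this.congr (Eventually.of_forall fun ξ => ?_)
    dsimp only
    rw [norm_weight_sq, norm_weight, mul_neg, Real.norm_eq_abs, sq_abs]
  exact hw.of_le_mul hα.aestronglyMeasurable_rootInv (Eventually.of_forall hC)

theorem IsSymbol.memLp_top_rootInv (hα : IsSymbol α s) :
    MemLp (fun η => (rootInv α η : ℂ)) ∞ volume := by
  obtain ⟨C, hC⟩ := hα.norm_rootInv_le
  refine memLp_top_of_bound hα.aestronglyMeasurable_rootInv |C| (Eventually.of_forall fun η => ?_)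
  refine (hC η).trans ?_
  have h1 : ‖weight (-s) η‖ ≤ 1 := by
    rw [norm_weight]
    exact Real.rpow_le_one_of_one_le_of_nonpos (by nlinarith [sq_nonneg η])
      (by linarith [hα.nonneg])
  nlinarith [le_abs_self C, abs_nonneg C, norm_nonneg (weight (-s) η)]

/-! ### `H^s` as the image of `L²` under `𝓛^{-1/2}` -/

/-- The operator `h ↦ 𝓕⁻¹ (α^{-1/2} h)` on `L²`, which is `𝓛^{-1/2}` applied to a function given by
its Fourier transform `h`. -/
def IsSymbol.rootOp (hα : IsSymbol α s) :
    L2R →L[ℂ] L2R :=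
  (Lp.fourierTransformₗᵢ ℝ ℂ).symm.toContinuousLinearEquiv.toContinuousLinearMap ∘L
    mulOp hα.memLp_top_rootInv

theorem represents_fourier_fourierInv (g : L2R) :
    Represents (𝓕 ((Lp.fourierTransformₗᵢ ℝ ℂ).symm g : 𝓢'(ℝ, ℂ))) g := by
  rw [Lp.fourier_toTemperedDistribution_eq]
  have : (𝓕 ((Lp.fourierTransformₗᵢ ℝ ℂ).symm g) : L2R) = g :=
    (Lp.fourierTransformₗᵢ ℝ ℂ).apply_symm_apply _
  rw [this]
  exact represents_lp g

theorem IsSymbol.represents_fourier_rootOp (hα : IsSymbol α s) (h : L2R) :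
    Represents (𝓕 (hα.rootOp h : 𝓢'(ℝ, ℂ))) (fun η => (rootInv α η : ℂ) * h η) :=
  (represents_fourier_fourierInv _).congr (coeFn_mulOp _ h)

theorem fourier_injective : Function.Injective (fun T : 𝓢'(ℝ, ℂ) => 𝓕 T) :=
  (fourierEquiv ℂ 𝓢'(ℝ, ℂ)).injective

theorem eq_iff_of_represents_fourier {T T' : 𝓢'(ℝ, ℂ)} {g g' : ℝ → ℂ}
    (h : Represents (𝓕 T) g) (h' : Represents (𝓕 T') g') : T = T' ↔ g =ᵐ[volume] g' :=
  ⟨fun e => by subst e; exact h.ae_eq h', fun e => fourier_injective ((h.congr e).dist_ext h')⟩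

theorem IsSymbol.rootOp_mem (hα : IsSymbol α s) (h : L2R) :
    (hα.rootOp h : 𝓢'(ℝ, ℂ)) ∈ Sobolev s := by
  obtain ⟨u, hu, hu'⟩ := exists_of_memLp (q := s) (memLp_weight_mul (q := 0) (g := h)
    hα.aestronglyMeasurable_rootInv (by simpa using hα.norm_rootInv_le) (Lp.aestronglyMeasurable h)
    (by simpa [weight_zero] using Lp.memLp h))
  have := (eq_iff_of_represents_fourier (hα.represents_fourier_rootOp h) hu').2 (by rfl)
  rwa [this]

/-- The parametrization `h ↦ 𝓕⁻¹ (α^{-1/2} h)` of `H^s` by `L²`. -/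
def IsSymbol.param (hα : IsSymbol α s) : L2R ≃ₗ[ℂ] Sobolev s :=
  LinearEquiv.ofBijective
    (((Lp.toTemperedDistributionCLM ℂ volume 2).toLinearMap ∘ₗ
      hα.rootOp.toLinearMap).codRestrict (Sobolev s) hα.rootOp_mem) <| by
    constructor
    · intro h h' hh
      have h1 : (hα.rootOp h : 𝓢'(ℝ, ℂ)) = (hα.rootOp h' : 𝓢'(ℝ, ℂ)) := congrArg Subtype.val hh
      apply Lp.ext
      filter_upwards [(eq_iff_of_represents_fourier (hα.represents_fourier_rootOp h)
        (hα.represents_fourier_rootOp h')).1 h1] with η hη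
      exact mul_left_cancel₀ (hα.rootInv_ne_zero η) hη
    · intro v
      obtain ⟨g, hg, hg'⟩ := exists_fourier_represents v.2
      have hm := memLp_weight_mul (r := 0) hα.aestronglyMeasurable_rootInv.inv₀
        (by simpa using hα.norm_inv_rootInv_le) hg.1 hg'
      simp only [weight_zero, one_mul] at hm
      refine ⟨hm.toLp, Subtype.ext ((eq_iff_of_represents_fourier
        (hα.represents_fourier_rootOp _) hg).2 ?_)⟩
      filter_upwards [hm.coeFn_toLp] with η hη
      rw [hη]
      exact mul_inv_cancel_left₀ (hα.rootInv_ne_zero η) _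

theorem IsSymbol.coe_param (hα : IsSymbol α s) (h : L2R) :
    (hα.param h : 𝓢'(ℝ, ℂ)) = (hα.rootOp h : 𝓢'(ℝ, ℂ)) := rfl

theorem IsSymbol.represents_fourier_opL_param (hα : IsSymbol α s)
    (h : L2R) :
    Represents (𝓕 (hα.opL (hα.param h) : 𝓢'(ℝ, ℂ))) (fun η => (rootInv α η : ℂ)⁻¹ * h η) := by
  obtain ⟨g, hg, hg'⟩ := hα.opL_spec (hα.param h)
  refine hg'.congr ?_
  filter_upwards [hg.ae_eq (hα.represents_fourier_rootOp h)] with η hη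
  rw [hη, ← mul_assoc, hα.symbol_mul_rootInv]

end root

/-! ### The linearized operators in `L²` -/

theorem coe_opMul {s : ℝ} (hs : 0 ≤ s) {V : ℝ → ℂ} (hV : MemLp V ∞ volume) {v : Sobolev s}
    {w : L2R} (hw : (v : 𝓢'(ℝ, ℂ)) = w) :
    (opMul hs hV v : 𝓢'(ℝ, ℂ)) = (mulOp hV w : 𝓢'(ℝ, ℂ)) :=
  (opMul_spec hs hV v).unique ⟨w, by rw [hw]; exact represents_lp w, represents_mulOp hV w⟩

section linearized
variable {α : ℝ → ℝ} {s : ℝ}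

/-- The Birman–Schwinger operator `𝓛^{-1/2} V 𝓛^{-1/2}`, conjugated by the Fourier transform. -/
def IsSymbol.birmanSchwinger (hα : IsSymbol α s) {V : ℝ → ℂ} (hV : MemLp V ∞ volume) :
    L2R →L[ℂ] L2R :=
  mulOp hα.memLp_top_rootInv ∘L
    (Lp.fourierTransformₗᵢ ℝ ℂ).toContinuousLinearEquiv.toContinuousLinearMap ∘L
      mulOp hV ∘L hα.rootOp

theorem IsSymbol.isCompactOperator_birmanSchwinger (hα : IsSymbol α s) {V : ℝ → ℂ}
    (hV : MemLp V ∞ volume) (hV2 : MemLp V 2 volume) :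
    IsCompactOperator (hα.birmanSchwinger hV) :=
  (isCompactOperator_mul_fourierInv_mul hV hV2 hα.memLp_top_rootInv hα.memLp_rootInv).clm_comp
    (mulOp hα.memLp_top_rootInv ∘L
      (Lp.fourierTransformₗᵢ ℝ ℂ).toContinuousLinearEquiv.toContinuousLinearMap)

theorem IsSymbol.inner_birmanSchwinger (hα : IsSymbol α s) {V : ℝ → ℂ} (hV : MemLp V ∞ volume)
    (g h : L2R) :
    ⟪hα.birmanSchwinger hV g, h⟫_ℂ = ⟪mulOp hV (hα.rootOp g), hα.rootOp h⟫_ℂ := by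
  have h1 : ∀ w, ⟪(Lp.fourierTransformₗᵢ ℝ ℂ) w, mulOp hα.memLp_top_rootInv h⟫_ℂ =
      ⟪w, (Lp.fourierTransformₗᵢ ℝ ℂ).symm (mulOp hα.memLp_top_rootInv h)⟫_ℂ := fun w => by
    rw [← (Lp.fourierTransformₗᵢ ℝ ℂ).inner_map_map w, LinearIsometryEquiv.apply_symm_apply]
  exact (SolitaryWave.inner_mulOp hα.memLp_top_rootInv _ h).trans (h1 _)

theorem IsSymbol.isSymmetric_birmanSchwinger (hα : IsSymbol α s) {V : ℝ → ℝ}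
    (hV : MemLp (fun x => (V x : ℂ)) ∞ volume) :
    (hα.birmanSchwinger hV : L2R →ₗ[ℂ] L2R).IsSymmetric := by
  intro g h
  simp only [ContinuousLinearMap.coe_coe]
  rw [hα.inner_birmanSchwinger, ← inner_conj_symm g, hα.inner_birmanSchwinger, inner_conj_symm,
    inner_mulOp]

/-- Multiplication by `1/α`, that is, `𝓛⁻¹` conjugated by the Fourier transform. -/
def IsSymbol.invOp (hα : IsSymbol α s) :
    L2R →L[ℂ] L2R :=
  mulOp hα.memLp_top_rootInv ∘L mulOp hα.memLp_top_rootInv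

theorem IsSymbol.inner_invOp (hα : IsSymbol α s) (g h : L2R) :
    ⟪hα.invOp g, h⟫_ℂ = ⟪hα.rootOp g, hα.rootOp h⟫_ℂ := by
  refine (inner_mulOp hα.memLp_top_rootInv _ h).trans ?_
  exact ((Lp.fourierTransformₗᵢ ℝ ℂ).symm.inner_map_map _ _).symm

theorem IsSymbol.re_inner_invOp (hα : IsSymbol α s) (h : L2R) :
    (⟪hα.invOp h, h⟫_ℂ).re = ‖hα.rootOp h‖ ^ 2 := by
  rw [hα.inner_invOp]
  simpa using inner_self_eq_norm_sq (𝕜 := ℂ) (hα.rootOp h)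

theorem IsSymbol.rootOp_injective (hα : IsSymbol α s) : Function.Injective hα.rootOp :=
  fun _ _ h => hα.param.injective (Subtype.ext (congrArg Lp.toTemperedDistribution h))

theorem IsSymbol.re_inner_birmanSchwinger_le (hα : IsSymbol α s) {V : ℝ → ℂ}
    (hV : MemLp V ∞ volume) (h : L2R) :
    (⟪hα.birmanSchwinger hV h, h⟫_ℂ).re ≤ ‖h‖ ^ 2 + ‖mulOp hV‖ * (⟪hα.invOp h, h⟫_ℂ).re := by
  rw [hα.inner_birmanSchwinger, hα.re_inner_invOp]
  refine ((Complex.re_le_norm _).trans (norm_inner_le_norm _ _)).trans ?_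
  nlinarith [(mulOp hV).le_opNorm (hα.rootOp h), norm_nonneg (hα.rootOp h), sq_nonneg ‖h‖]

variable {hα : IsSymbol α s} {f φ : ℝ → ℝ} {u : Sobolev s}

/-- Since `φ` is bounded and `|f'(r)|` is at most a multiple of `|r|` on bounded sets (`q₁ ≥ 2`), the
potential `f'(φ)` inherits square integrability from `φ`. -/
theorem IsSolution.memLp_two_potential (hf : IsNonlinearity f) (hφ : IsSolution hα f φ u) :
    MemLp (fun x => ((deriv f (φ x) : ℝ) : ℂ)) 2 volume := by
  obtain ⟨w, hw⟩ := TemperedDistribution.memSobolev_zero_iff.1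
    (TemperedDistribution.MemSobolev.mono hα.nonneg u.2)
  have hφ2 : MemLp (fun x => (φ x : ℂ)) 2 volume := by
    refine (memLp_congr_ae ?_).1 (Lp.memLp w)
    have h1 := hφ.represents
    rw [hw] at h1
    exact (represents_lp w).ae_eq h1
  obtain ⟨B, hB⟩ := sobolev_ae_bounded hα.half_lt u hφ.represents
  obtain ⟨q₁, q₂, C, hq₁, hq₂, hC, hgr⟩ := hf.growth
  refine hφ2.of_le_mul (c := C * (|B| ^ (q₁ - 2) + |B| ^ (q₂ - 2)))
    (hφ.potential_memLp hf).1 ?_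
  filter_upwards [hB] with x hx
  rw [Complex.norm_real, Real.norm_eq_abs] at hx ⊢
  rw [Complex.norm_real, Real.norm_eq_abs]
  have hpow : ∀ q : ℝ, 2 ≤ q → |φ x| ^ (q - 1) ≤ |B| ^ (q - 2) * |φ x| := by
    intro q hq
    rcases (abs_nonneg (φ x)).eq_or_lt with h0 | h0
    · rw [← h0, Real.zero_rpow (by linarith), mul_zero]
    · rw [show q - 1 = (q - 2) + 1 by ring, Real.rpow_add h0, Real.rpow_one]
      exact mul_le_mul_of_nonneg_right (Real.rpow_le_rpow (abs_nonneg _)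
        (hx.trans (le_abs_self B)) (by linarith)) (abs_nonneg _)
  calc |deriv f (φ x)| ≤ C * (|φ x| ^ (q₁ - 1) + |φ x| ^ (q₂ - 1)) := hgr _
    _ ≤ C * (|B| ^ (q₁ - 2) * |φ x| + |B| ^ (q₂ - 2) * |φ x|) := by
        gcongr
        · exact hpow q₁ hq₁
        · exact hpow q₂ (hq₁.trans hq₂)
    _ = _ := by ring

/-- Through the parametrization, `α^{-1/2} 𝓕 𝓗` becomes `1 - K` with the Birman–Schwinger
operator `K` of the potential `f'(φ)`. -/
theorem represents_fourier_opH_param (hf : IsNonlinearity f) (hφ : IsSolution hα f φ u)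
    (h : L2R) :
    Represents (𝓕 (opH hf hφ (hα.param h) : 𝓢'(ℝ, ℂ))) (fun η => (rootInv α η : ℂ)⁻¹ *
      ((1 - hα.birmanSchwinger (hφ.potential_memLp hf) : L2R →L[ℂ] L2R) h) η)
    := by
  set V := hφ.potential_memLp hf
  set w := (Lp.fourierTransformₗᵢ ℝ ℂ) (mulOp V (hα.rootOp h)) with hw
  have h1 : Represents (𝓕 (opMul hα.nonneg V (hα.param h) : 𝓢'(ℝ, ℂ))) w := by
    rw [coe_opMul hα.nonneg V (hα.coe_param h), Lp.fourier_toTemperedDistribution_eq]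
    exact represents_lp _
  have h2 := (hα.represents_fourier_opL_param h).add (h1.smul (-1))
  have h3 : 𝓕 (opH hf hφ (hα.param h) : 𝓢'(ℝ, ℂ)) = 𝓕 (hα.opL (hα.param h) : 𝓢'(ℝ, ℂ)) +
      (-1 : ℂ) • 𝓕 (opMul hα.nonneg V (hα.param h) : 𝓢'(ℝ, ℂ)) := by
    rw [← FourierTransform.fourier_smul, ← FourierTransform.fourier_add]
    congr 1
    have hsub : ∀ S S' : 𝓢'(ℝ, ℂ), S - S' = S + (-1 : ℂ) • S' := fun S S' => by module
    exact hsub _ _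
  rw [h3]
  refine h2.congr ?_
  filter_upwards [Lp.coeFn_sub h (hα.birmanSchwinger V h),
    coeFn_mulOp hα.memLp_top_rootInv w] with η e1 e2
  have e3 : (hα.birmanSchwinger V h : ℝ → ℂ) η = rootInv α η * w η := e2
  have e4 : (((1 - hα.birmanSchwinger V : L2R →L[ℂ] L2R) h :
      L2R) : ℝ → ℂ) η = h η - rootInv α η * w η := by
    rw [← e3]
    exact e1
  rw [e4, mul_sub, inv_mul_cancel_left₀ (hα.rootInv_ne_zero η)]
  ring

theorem param_mem_eigenspace_opH (hf : IsNonlinearity f) (hφ : IsSolution hα f φ u) (μ : ℝ)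
    (h : L2R) :
    hα.param h ∈ eigenspace (incl hα) (opH hf hφ) μ ↔
      h ∈ eigenspace (hα.invOp : L2R →ₗ[ℂ] L2R)
        ((1 - hα.birmanSchwinger (hφ.potential_memLp hf) :
          L2R →L[ℂ] L2R) : L2R →ₗ[ℂ] L2R) μ := by
  rw [mem_eigenspace_iff, mem_eigenspace_iff, Subtype.ext_iff]
  have h1 : Represents (𝓕 (((μ : ℂ) • incl hα (hα.param h) : Sobolev (-s)) : 𝓢'(ℝ, ℂ)))
      (fun η => (μ : ℂ) * ((rootInv α η : ℂ) * h η)) := by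
    have h2 := (hα.represents_fourier_rootOp h).smul (μ : ℂ)
    rw [← FourierTransform.fourier_smul] at h2
    exact h2
  rw [eq_iff_of_represents_fourier (represents_fourier_opH_param hf hφ h) h1, Lp.ext_iff]
  have h2 := Lp.coeFn_smul (μ : ℂ) (hα.invOp h)
  have h3 := coeFn_mulOp hα.memLp_top_rootInv (mulOp hα.memLp_top_rootInv h)
  have h4 := coeFn_mulOp hα.memLp_top_rootInv h
  refine eventually_congr ?_
  filter_upwards [h2, h3, h4] with η e2 e3 e4
  have e5 : (((μ : ℂ) • hα.invOp h : L2R) : ℝ → ℂ) η =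
      μ * (rootInv α η * (rootInv α η * h η)) := by
    rw [e2, Pi.smul_apply, smul_eq_mul, ← e4, ← e3]
    rfl
  have e6 : μ * (rootInv α η * (rootInv α η * h η)) =
    (rootInv α η : ℂ) * (μ * (rootInv α η * h η)) := by ring
  simp only [ContinuousLinearMap.coe_coe]
  rw [e5, e6, inv_mul_eq_iff_eq_mul₀ (hα.rootInv_ne_zero η)]

theorem param_mem_eigenspace_opH₀ (hf : IsNonlinearity f) (hφ : IsSolution hα f φ u) (ν : ℝ)
    (h : L2R) :
    hα.param h ∈ eigenspace LinearMap.id (opH₀ hf hφ) ν ↔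
      h ∈ eigenspace LinearMap.id
        ((1 - hα.birmanSchwinger (hφ.potential_memLp hf) :
          L2R →L[ℂ] L2R) : L2R →ₗ[ℂ] L2R) ν := by
  rw [mem_eigenspace_iff, mem_eigenspace_iff]
  have h0 : opH₀ hf hφ (hα.param h) =
      (ν : ℂ) • (LinearMap.id : Sobolev s →ₗ[ℂ] Sobolev s) (hα.param h) ↔
      opH hf hφ (hα.param h) = (ν : ℂ) • hα.opL (hα.param h) := by
    rw [← hα.opL.map_smul]
    exact hα.equivL.symm_apply_eq
  rw [h0, Subtype.ext_iff]
  have h1 : Represents (𝓕 (((ν : ℂ) • hα.opL (hα.param h) : Sobolev (-s)) : 𝓢'(ℝ, ℂ)))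
      (fun η => (ν : ℂ) * ((rootInv α η : ℂ)⁻¹ * h η)) := by
    have h2 := (hα.represents_fourier_opL_param h).smul (ν : ℂ)
    rw [← FourierTransform.fourier_smul] at h2
    exact h2
  rw [eq_iff_of_represents_fourier (represents_fourier_opH_param hf hφ h) h1, Lp.ext_iff]
  refine eventually_congr ?_
  filter_upwards [Lp.coeFn_smul (ν : ℂ) h] with η e2
  simp only [ContinuousLinearMap.coe_coe, LinearMap.id_apply]
  rw [e2, Pi.smul_apply, smul_eq_mul, mul_left_comm (ν : ℂ)]
  exact mul_right_inj' (inv_ne_zero (hα.rootInv_ne_zero η))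

/-- The hypothesis only depends on the eigenspaces up to a linear isomorphism of the domains. -/
theorem HypH1.congr {V V' W W' : Type*} [AddCommGroup V] [Module ℂ V] [AddCommGroup W]
    [Module ℂ W] [AddCommGroup V'] [Module ℂ V'] [AddCommGroup W'] [Module ℂ W']
    {j A : V →ₗ[ℂ] W} {j' A' : V' →ₗ[ℂ] W'} (e : V ≃ₗ[ℂ] V')
    (he : ∀ μ v, e v ∈ eigenspace j' A' μ ↔ v ∈ eigenspace j A μ) :
    HypH1 j' A' ↔ HypH1 j A := by
  have hmap : ∀ μ, eigenspace j' A' μ = (eigenspace j A μ).map (e : V →ₗ[ℂ] V') := by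
    intro μ
    ext v
    obtain ⟨w, rfl⟩ := e.surjective v
    rw [he]
    simp
  have hfin : ∀ μ, Module.finrank ℂ (eigenspace j' A' μ) = Module.finrank ℂ (eigenspace j A μ) :=
    fun μ => by rw [hmap, LinearEquiv.finrank_map_eq]
  have hbot : ∀ μ, eigenspace j' A' μ = ⊥ ↔ eigenspace j A μ = ⊥ :=
    fun μ => by rw [hmap, Submodule.map_eq_bot_iff]
  simp only [HypH1, hfin, ne_eq, hbot]

theorem ker_opH₀ (hf : IsNonlinearity f) (hφ : IsSolution hα f φ u) :
    LinearMap.ker (opH₀ hf hφ) = LinearMap.ker (opH hf hφ) :=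
  LinearEquiv.ker_comp _ _

end linearized

end SolitaryWave

end

theorem theoremT (α : ℝ → ℝ) (s : ℝ) (hα : SolitaryWave.IsSymbol α s)
    (f : ℝ → ℝ) (hf : SolitaryWave.IsNonlinearity f)
    (φ : ℝ → ℝ) (u : SolitaryWave.Sobolev s) (hφ : SolitaryWave.IsSolution hα f φ u)
    (h₁ : SolitaryWave.HypH1 LinearMap.id (SolitaryWave.opH₀ hf hφ))
    (h₂ : SolitaryWave.HypH2 (SolitaryWave.opH₀ hf hφ) u) :
    SolitaryWave.HypH1 (SolitaryWave.incl hα) (SolitaryWave.opH hf hφ) ∧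
      SolitaryWave.HypH2 (SolitaryWave.opH hf hφ) u := by
  refine ⟨?_, by rwa [SolitaryWave.HypH2, ← SolitaryWave.ker_opH₀]⟩
  rw [SolitaryWave.HypH1.congr hα.param (SolitaryWave.param_mem_eigenspace_opH₀ hf hφ)] at h₁
  rw [SolitaryWave.HypH1.congr hα.param (SolitaryWave.param_mem_eigenspace_opH hf hφ)]
  refine SolitaryWave.HypH1.of_compact
    (hα.isCompactOperator_birmanSchwinger _ (hφ.memLp_two_potential hf))
    (hα.isSymmetric_birmanSchwinger _) (fun g h => ?_) (fun h h0 => ?_)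
    (hα.re_inner_birmanSchwinger_le (hφ.potential_memLp hf)) h₁
  · exact (SolitaryWave.inner_mulOp hα.memLp_top_rootInv _ h).trans
      (SolitaryWave.inner_mulOp hα.memLp_top_rootInv _ _)
  · rw [hα.re_inner_invOp]
    have := (map_ne_zero_iff hα.rootOp hα.rootOp_injective).2 h0
    positivity
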